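/- Let $k\ge 2$, and let $V_k$ be the set of points of $\mathbf N^k$ ($\mathbf N=\{1,2,\dots\}$) visible from the origin, that is, the points $\mathbf x\in\mathbf N^k$ such that no point of $\mathbf Z^k$ lies strictly between $\mathbf 0$ and $\mathbf x$ on the segment joining them. Then, as $L\to\infty$ through the positive integers, $$\left|V_k\cap[1,L]^k\right|=\frac{L^k}{\zeta(k)}+\Omega_{\pm}(L^{k-1}),$$ that is, there is a constant $c=c(k)>0$ such that $\left|V_k\cap[1,L]^k\right|-L^k/\zeta(k)\ge cL^{k-1}$ for infinitely many positive integers $L$ and $\left|V_k\cap[1,L]^k\right|-L^k/\zeta(k)\le -cL^{k-1}$ for infinitely many positive integers $L$. In particular, the asymptotic density $D(V_k)=\lim_{L\to\infty}|V_k\cap[1,L]^k|/L^k$ exists and equals $1/\zeta(k)$, and the Schnirelmann density $\mathrm{SD}(V_k)=\inf_{L\ge1}|V_k\cap[1,L]^k|/L^k$ satisfies $$\mathrm{SD}(V_k)<D(V_k)=\frac1{\zeta(k)}.$$ Moreover, if $k\ge3$, then as $L\to\infty$ through the positive integers $$\left|V_k\cap[1,L]^k\right|=\frac{L^k}{\zeta(k)}-kM(L)L^{k-1}+O_k(L^{k-2}\log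 L),\qquad M(L)=\sum_{d=1}^{L}\frac{\mu(d)}{d^{k-1}}\left\{\frac Ld\right\},$$ where $\mu$ is the Möbius function and $\{t\}$ is the fractional part of $t$. -/

import Mathlib

open Filter Topology Asymptotics

noncomputable section

namespace LatticeVisibility

/-- The embedding of the integer lattice `ℤ^k` into `ℝ^k`. -/
def toReal {k : ℕ} (x : Fin k → ℤ) : Fin k → ℝ := fun i => (x i : ℝ)

/-- Two distinct points of `ℤ^k` are mutually visible if no lattice point lies strictly between
them on the line segment joining them. -/
def MutuallyVisible {k : ℕ} (x y : Fin k → ℤ) : Prop :=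
  x ≠ y ∧ IsVisible ℝ (Set.range (toReal (k := k))) (toReal x) (toReal y)

/-- `V(S)`: the points of `ℤ^k` visible simultaneously from all points of `S`. -/
def visibleFrom {k : ℕ} (S : Set (Fin k → ℤ)) : Set (Fin k → ℤ) :=
  {x | ∀ y ∈ S, MutuallyVisible y x}

/-- `V_k`: the points with positive integer coordinates that are visible from the origin. -/
def visibleFromOrigin (k : ℕ) : Set (Fin k → ℤ) :=
  visibleFrom {0} ∩ {x | ∀ i, 1 ≤ x i}

/-- The discrete cube `[1, L]^k` in `ℤ^k`. -/
def cube (k L : ℕ) : Set (Fin k → ℤ) := {x | ∀ i, 1 ≤ x i ∧ x i ≤ (L : ℤ)}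

/-- `|A ∩ [1, L]^k|` (the cube is a finite set). -/
def count {k : ℕ} (A : Set (Fin k → ℤ)) (L : ℕ) : ℕ := (A ∩ cube k L).ncard

/-- The asymptotic density `lim_{L → ∞} |A ∩ [1, L]^k| / L^k` exists and equals `δ`. -/
def HasAsymptoticDensity {k : ℕ} (A : Set (Fin k → ℤ)) (δ : ℝ) : Prop :=
  Tendsto (fun L : ℕ => (count A L : ℝ) / (L : ℝ) ^ k) atTop (𝓝 δ)

/-- The Schnirelmann density `inf_{L ≥ 1} |A ∩ [1, L]^k| / L^k`. -/
def schnirelmannDensity {k : ℕ} (A : Set (Fin k → ℤ)) : ℝ :=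
  ⨅ L : {L : ℕ // 0 < L}, (count A (L : ℕ) : ℝ) / ((L : ℕ) : ℝ) ^ k

/-- `f = Ω_+(g)`, for eventually positive `g`: for some `c > 0`, `f(L) ≥ c g(L)` for infinitely
many positive integers `L`. -/
def IsOmegaPlus (f g : ℕ → ℝ) : Prop := ∃ c : ℝ, 0 < c ∧ ∃ᶠ L in atTop, c * g L ≤ f L

/-- `f = Ω_-(g)`, for eventually positive `g`: for some `c > 0`, `f(L) ≤ -c g(L)` for infinitely
many positive integers `L`. -/
def IsOmegaMinus (f g : ℕ → ℝ) : Prop := ∃ c : ℝ, 0 < c ∧ ∃ᶠ L in atTop, f L ≤ -(c * g L)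

/-- `f = Ω_±(g)`: both `f = Ω_+(g)` and `f = Ω_-(g)`. -/
def IsOmegaPlusMinus (f g : ℕ → ℝ) : Prop := IsOmegaPlus f g ∧ IsOmegaMinus f g

/-- The value `ζ(k)` of the Riemann zeta function at a natural number `k`, as a real number
(for `k ≥ 2`, Mathlib's complex value has imaginary part `0`). -/
def zeta (k : ℕ) : ℝ := (riemannZeta (k : ℂ)).re

/-- `M(L) = ∑_{d ≤ L} μ(d) d^{1-k} {L/d}`, with `{·}` the fractional part. -/
def fracSum (k L : ℕ) : ℝ :=
  ∑ d ∈ Finset.Icc 1 L,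
    (ArithmeticFunction.moebius d : ℝ) / (d : ℝ) ^ (k - 1) * Int.fract ((L : ℝ) / (d : ℝ))

end LatticeVisibility

end

/-! ### Visibility, coprimality and Möbius inversion -/

noncomputable section

namespace LatticeVisibility

open scoped ArithmeticFunction.Moebius

/-! A point with positive coordinates is visible from the origin iff their gcd is 1, so Möbius
inversion expresses the count as `∑ μ(d) ⌊L/d⌋^k`. Subtracting `L^k/ζ(k) = ∑ μ(d) (L/d)^k` leaves
the error `E(L) = ∑ μ(d) (⌊L/d⌋^k - (L/d)^k)` (`hasSum_coprimeError`). The bound `E(x) = O(x^s)` for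
`k - 1 < s ≤ k` gives the density, expanding `⌊u⌋^k` to first order in `{u}` gives the formula with
`M(L)`, and a single `L` with `E(L) < 0` gives the strict Schnirelmann inequality. The work is in
the two oscillation statements.

For `k ≥ 3` the terms of `E(L)/L^(k-1)` are dominated by `k/d^(k-1)`, so along any sequence whose
residues `r_d` modulo squarefree `d` stabilise, the quotient tends to `-k ∑ μ(d) r_d/d^k`
(`tendsto_coprimeError_div`). Taking `L = n! + 1` gives `k(1 - 1/ζ(k)) > 0`. For a negative limit
take `L ≡ 1` modulo a prime `p` and divisible by all small integers prime to `p`: the limit is a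
positive multiple of `∑ μ(m) m^(1-k) {m⁻¹/p}`, with `m⁻¹` the inverse modulo `p`. If `p ≡ -1` modulo
`N!`, then `m⁻¹ = (p+1)/m` for `2 ≤ m ≤ N`, and as `N` grows the sum tends to `1/ζ(k) - 1 < 0`
(`exists_prime_inverseSum_neg`).

For `k = 2` the domination fails, and averaging replaces it. The Mellin transform of `E` is `1/ζ(σ)`
times an integral of size `O(1/(σ-1))`, hence bounded as `σ → 1+`. On `[L, L+1)` the average of
`E(x)` is about `E(L) - κL`, where `κ = 1/ζ(2)`. So `E(L) - κL` has logarithmic mean zero after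
division by `L`, in the sense that no `p(L) L - C` with `p` periodic of positive mean can lie below
it or below its negative (`not_periodic_le_coprimeError`). This at once rules out `E(L) < κL/2` for
all large `L`.

For the other sign, suppose `E(L) > -εL` for all large `L`. Each `L` is compared with the next
integer `L + e(L)` in a fixed class modulo `Q`: the increments of `E` are controlled by `φ`, and
`φ(l)/l` is at most a finite product over primes. This bounds `E(L)` below by a periodic multiple of
`L`, up to `O(1)`. A contradiction follows once that multiple has mean above `κ`, which reduces to
the explicit inequality `sawtoothSum_lt`. -/

/-- `∑_{d ≤ L} μ(d) ⌊L/d⌋^k`, the number of points of `[1, L]^k` with coprime coordinates. -/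
def coprimeCount (k L : ℕ) : ℤ := ∑ d ∈ Finset.Icc 1 L, μ d * ((L / d : ℕ) : ℤ) ^ k

/-- If `g > 1`, the lattice point `x / g` lies strictly between the origin and `x`. -/
lemma eq_one_of_dvd_of_mutuallyVisible {k : ℕ} {x : Fin k → ℤ} (h : MutuallyVisible 0 x)
    {g : ℤ} (hg : ∀ i, g ∣ x i) (hg0 : 0 < g) : g = 1 := by
  by_contra hne
  obtain ⟨hx0, hv⟩ := h
  choose z hz using hg
  refine hv ⟨z, rfl⟩ ⟨⟨(g : ℝ)⁻¹, ⟨by positivity, ?_⟩, ?_⟩, ?_, ?_⟩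
  · exact inv_le_one_of_one_le₀ (by exact_mod_cast hg0)
  · have hgr : (g : ℝ) ≠ 0 := by exact_mod_cast hg0.ne'
    ext i
    simp only [AffineMap.lineMap_apply, toReal, vsub_eq_sub, vadd_eq_add, Pi.add_apply,
      Pi.smul_apply, Pi.sub_apply, smul_eq_mul, Pi.zero_apply, Int.cast_zero, sub_zero, add_zero]
    rw [hz i]
    push_cast
    field_simp
  · intro hzero
    apply hx0
    ext i
    have := congrFun hzero i
    simp only [toReal, Pi.zero_apply, Int.cast_inj] at this
    rw [hz i, this]; simp
  · intro hzx
    apply hx0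
    ext i
    have := congrFun hzx i
    simp only [toReal, Int.cast_inj] at this
    have h1 := hz i
    rw [← this] at h1
    have h2 : (g - 1) * z i = 0 := by linarith
    rcases mul_eq_zero.1 h2 with h3 | h3
    · omega
    · rw [hz i, h3]; simp

/-- If `t • x` is a lattice point, Bézout coefficients of the coordinates of `x` exhibit `t` as an
integer; in `[0, 1]` this leaves only the endpoints. -/
lemma mutuallyVisible_zero_of_gcd {k : ℕ} {x : Fin k → ℤ} (h : Finset.univ.gcd x = 1) :
    MutuallyVisible 0 x := by
  refine ⟨?_, ?_⟩
  · rintro rfl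
    have : Finset.univ.gcd (0 : Fin k → ℤ) = 0 := by
      rw [Finset.gcd_eq_zero_iff]; simp
    omega
  · rintro _ ⟨z, rfl⟩ ⟨⟨t, ⟨ht0, ht1⟩, ht⟩, hz0, hzx⟩
    have hti : ∀ i, t * (x i : ℝ) = z i := fun i => by
      have := congrFun ht i
      simpa [AffineMap.lineMap_apply, toReal] using this
    obtain ⟨c, hc⟩ := Finset.gcd_eq_sum_mul Finset.univ x
    rw [h] at hc
    have htint : t = ((∑ i, z i * c i : ℤ) : ℝ) := by
      calc t = t * ((1 : ℤ) : ℝ) := by simp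
        _ = t * ((∑ i, x i * c i : ℤ) : ℝ) := by rw [hc]
        _ = _ := by
          push_cast
          rw [Finset.mul_sum]
          refine Finset.sum_congr rfl fun i _ => ?_
          rw [← hti i]; ring
    set n : ℤ := ∑ i, z i * c i
    rw [htint] at ht0 ht1
    have h0 : 0 ≤ n := by exact_mod_cast ht0
    have h1 : n ≤ 1 := by exact_mod_cast ht1
    rcases (by omega : n = 0 ∨ n = 1) with hn | hn
    · apply hz0
      ext i
      have := hti i
      rw [htint, hn] at this
      simpa [toReal] using this.symm
    · apply hzx
      ext i
      have := hti i
      rw [htint, hn] at this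
      simpa [toReal] using this.symm

lemma mutuallyVisible_zero_iff {k : ℕ} (hk : k ≠ 0) {x : Fin k → ℤ} (hx : ∀ i, 1 ≤ x i) :
    MutuallyVisible 0 x ↔ Finset.univ.gcd (fun i => (x i).toNat) = 1 := by
  have : NeZero k := ⟨hk⟩
  constructor
  · intro h
    have h1 : ∀ i, ((Finset.univ.gcd (fun i => (x i).toNat) : ℕ) : ℤ) ∣ x i := fun i => by
      have := Finset.gcd_dvd (f := fun i => (x i).toNat) (Finset.mem_univ i)
      have h2 := Int.natCast_dvd_natCast.2 this
      rwa [Int.toNat_of_nonneg (by linarith [hx i])] at h2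
    have h0 : 0 < Finset.univ.gcd (fun i => (x i).toNat) := by
      rw [Nat.pos_iff_ne_zero, Ne, Finset.gcd_eq_zero_iff]
      intro h
      have := h 0 (Finset.mem_univ _)
      have := hx 0
      omega
    exact_mod_cast eq_one_of_dvd_of_mutuallyVisible h h1 (by exact_mod_cast h0)
  · intro h
    apply mutuallyVisible_zero_of_gcd
    have hd : ∀ i, (Finset.univ.gcd x).toNat ∣ (x i).toNat := fun i => by
      have h1 := Finset.gcd_dvd (f := x) (Finset.mem_univ i)
      have h0 : 0 ≤ Finset.univ.gcd x := by
        rw [← Finset.normalize_gcd]; exact Int.nonneg_of_normalize_eq_self (normalize_idem _)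
      rw [← Int.natCast_dvd_natCast, Int.toNat_of_nonneg h0,
        Int.toNat_of_nonneg (by linarith [hx i])]
      exact h1
    have := Finset.dvd_gcd (s := Finset.univ) (fun i _ => hd i)
    rw [h] at this
    have := Nat.dvd_one.1 this
    omega

lemma count_visibleFromOrigin_eq_card {k : ℕ} (hk : k ≠ 0) (L : ℕ) :
    count (visibleFromOrigin k) L =
      ((Fintype.piFinset fun _ : Fin k => Finset.Icc 1 L).filter
        fun x => Finset.univ.gcd x = 1).card := by
  rw [count, ← Set.ncard_coe_finset]
  refine Set.ncard_congr (fun x _ i => (x i).toNat) ?_ ?_ ?_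
  · rintro x ⟨⟨hv, h1⟩, hc⟩
    simp only [Finset.coe_filter, Fintype.mem_piFinset, Finset.mem_Icc, Set.mem_ofPred_eq]
    refine ⟨fun i => ?_, (mutuallyVisible_zero_iff hk h1).1 (hv 0 rfl)⟩
    have := hc i
    omega
  · rintro x y ⟨⟨-, hx⟩, -⟩ ⟨⟨-, hy⟩, -⟩ hxy
    ext i
    have := congrFun hxy i
    have h1 := hx i
    have h2 := hy i
    omega
  · intro y hy
    simp only [Finset.coe_filter, Fintype.mem_piFinset, Finset.mem_Icc, Set.mem_ofPred_eq] at hy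
    have h1 : ∀ i, (1 : ℤ) ≤ (y i : ℤ) := fun i => by exact_mod_cast (hy.1 i).1
    refine ⟨fun i => (y i : ℤ), ⟨⟨?_, h1⟩, fun i => ⟨h1 i, Int.ofNat_le.2 (hy.1 i).2⟩⟩, ?_⟩
    · rintro _ rfl
      rw [mutuallyVisible_zero_iff hk h1]
      simpa using hy.2
    · ext i; simp

lemma sum_moebius_filter_dvd {L n : ℕ} (hn : 1 ≤ n) (hnL : n ≤ L) :
    ∑ d ∈ Finset.Icc 1 L, (if d ∣ n then μ d else 0) = if n = 1 then 1 else 0 := by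
  rw [← Finset.sum_filter]
  have : (Finset.Icc 1 L).filter (· ∣ n) = n.divisors := by
    ext d
    simp only [Finset.mem_filter, Finset.mem_Icc, Nat.mem_divisors]
    constructor
    · rintro ⟨_, h⟩; exact ⟨h, by omega⟩
    · rintro ⟨h, _⟩
      have := Nat.le_of_dvd hn h
      have := Nat.pos_of_dvd_of_pos h hn
      exact ⟨⟨by omega, by omega⟩, h⟩
  rw [this, ← ArithmeticFunction.coe_mul_zeta_apply, ArithmeticFunction.moebius_mul_coe_zeta,
    ArithmeticFunction.one_apply]

lemma card_filter_dvd_piFinset (k L d : ℕ) :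
    ((Fintype.piFinset fun _ : Fin k => Finset.Icc 1 L).filter
      fun x => d ∣ Finset.univ.gcd x).card = (L / d) ^ k := by
  have : ((Fintype.piFinset fun _ : Fin k => Finset.Icc 1 L).filter
      fun x => d ∣ Finset.univ.gcd x) =
      Fintype.piFinset fun _ : Fin k => (Finset.Ioc 0 L).filter (d ∣ ·) := by
    ext x
    simp only [Finset.mem_filter, Fintype.mem_piFinset, Finset.dvd_gcd_iff, Finset.mem_univ,
      true_imp_iff, Finset.mem_Icc, Finset.mem_Ioc, Nat.succ_le_iff, ← forall_and]
  rw [this, Fintype.card_piFinset]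
  simp [Nat.Ioc_filter_dvd_card_eq_div]

/-- The indicator of `gcd = 1` is the sum of `μ` over divisors of the gcd. Since the gcd is at most
`L`, all these divisors are in `[1, L]`, and the sums can be exchanged. -/
lemma count_visibleFromOrigin {k : ℕ} (hk : k ≠ 0) (L : ℕ) :
    (count (visibleFromOrigin k) L : ℤ) = coprimeCount k L := by
  have : NeZero k := ⟨hk⟩
  rw [count_visibleFromOrigin_eq_card hk, Finset.card_filter, coprimeCount]
  push_cast
  have h1 : ∀ x ∈ Fintype.piFinset fun _ : Fin k => Finset.Icc 1 L,
      (if Finset.univ.gcd x = 1 then (1 : ℤ) else 0) =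
        ∑ d ∈ Finset.Icc 1 L, (if d ∣ Finset.univ.gcd x then μ d else 0) := by
    intro x hx
    simp only [Fintype.mem_piFinset, Finset.mem_Icc] at hx
    have hd : Finset.univ.gcd x ∣ x 0 := Finset.gcd_dvd (Finset.mem_univ 0)
    have h0 := hx 0
    exact (sum_moebius_filter_dvd (Nat.pos_of_dvd_of_pos hd (by omega))
      ((Nat.le_of_dvd (by omega) hd).trans h0.2)).symm
  rw [Finset.sum_congr rfl h1, Finset.sum_comm]
  refine Finset.sum_congr rfl fun d _ => ?_
  rw [← Finset.sum_filter, Finset.sum_const, card_filter_dvd_piFinset, nsmul_eq_mul, mul_comm]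
  push_cast
  rfl

end LatticeVisibility

end

/-! ### The Möbius series, the error term, and the two densities -/

noncomputable section

namespace LatticeVisibility

open scoped ArithmeticFunction.Moebius

lemma abs_moebius_cast_le_one (d : ℕ) : |(μ d : ℝ)| ≤ 1 := by
  exact_mod_cast ArithmeticFunction.abs_moebius_le_one

lemma summable_moebius_mul {f g : ℕ → ℝ} (hg : Summable g) (hfg : ∀ d, |f d| ≤ g d) :
    Summable fun d => (μ d : ℝ) * f d := by
  refine Summable.of_norm_bounded hg fun d => ?_
  rw [Real.norm_eq_abs, abs_mul]
  calc |(μ d : ℝ)| * |f d| ≤ 1 * |f d| := by gcongr; exact abs_moebius_cast_le_one d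
    _ ≤ g d := by rw [one_mul]; exact hfg d

lemma summable_moebius_div_pow {k : ℕ} (hk : 2 ≤ k) :
    Summable fun n : ℕ => (μ n : ℝ) * (1 / (n : ℝ) ^ k) :=
  summable_moebius_mul (Real.summable_one_div_nat_pow.2 hk) fun d => by
    rw [abs_of_nonneg (by positivity)]

lemma tsum_mul_tsum_moebius_rpow {s : ℝ} (hs : 1 < s) :
    (∑' n : ℕ, 1 / (n : ℝ) ^ s) * ∑' n : ℕ, (μ n : ℝ) * (1 / (n : ℝ) ^ s) = 1 := by
  have hs' : 1 < (s : ℂ).re := by simpa using hs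
  have h := ArithmeticFunction.LSeries_zeta_mul_Lseries_moebius hs'
  rw [ArithmeticFunction.LSeries_zeta_eq_riemannZeta hs',
    zeta_eq_tsum_one_div_nat_cpow hs'] at h
  have h1 : LSeries (fun n => ((μ n : ℤ) : ℂ)) s =
      ((∑' n : ℕ, (μ n : ℝ) * (1 / (n : ℝ) ^ s) : ℝ) : ℂ) := by
    rw [LSeries, Complex.ofReal_tsum]
    refine tsum_congr fun n => ?_
    rcases eq_or_ne n 0 with rfl | hn
    · simp
    · rw [LSeries.term_of_ne_zero hn]
      push_cast
      rw [Complex.ofReal_cpow (by positivity)]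
      push_cast
      ring
  have h2 : (∑' n : ℕ, 1 / (n : ℂ) ^ (s : ℂ)) = ((∑' n : ℕ, 1 / (n : ℝ) ^ s : ℝ) : ℂ) := by
    rw [Complex.ofReal_tsum]
    refine tsum_congr fun n => ?_
    push_cast
    rw [Complex.ofReal_cpow (by positivity)]
    push_cast
    ring
  rw [h1, h2] at h
  exact_mod_cast h

lemma zeta_eq_tsum {k : ℕ} (hk : 2 ≤ k) : zeta k = ∑' n : ℕ, 1 / (n : ℝ) ^ k := by
  rw [zeta, zeta_nat_eq_tsum_of_gt_one (by omega)]
  have : (∑' n : ℕ, 1 / (n : ℂ) ^ k) = ((∑' n : ℕ, 1 / (n : ℝ) ^ k : ℝ) : ℂ) := by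
    push_cast; rfl
  rw [this, Complex.ofReal_re]

lemma one_div_zeta {k : ℕ} (hk : 2 ≤ k) :
    1 / zeta k = ∑' n : ℕ, (μ n : ℝ) * (1 / (n : ℝ) ^ k) := by
  have h := tsum_mul_tsum_moebius_rpow (s := k) (by exact_mod_cast hk)
  simp only [Real.rpow_natCast] at h
  rw [← zeta_eq_tsum hk] at h
  have : zeta k ≠ 0 := left_ne_zero_of_mul_eq_one h
  rw [div_eq_iff this, mul_comm]
  exact h.symm

lemma one_lt_zeta {k : ℕ} (hk : 2 ≤ k) : 1 < zeta k := by
  rw [zeta_eq_tsum hk]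
  have hs : Summable fun n : ℕ => 1 / (n : ℝ) ^ k := Real.summable_one_div_nat_pow.2 hk
  have := hs.sum_le_tsum {1, 2} fun n _ => by positivity
  rw [Finset.sum_pair (by norm_num)] at this
  have h2 : (0 : ℝ) < 1 / ((2 : ℕ) : ℝ) ^ k := by positivity
  simp only [Nat.cast_one, one_pow, div_one] at this
  linarith

/-- The series is the reciprocal of `ζ(s)`, and `(s - 1) ζ(s) → 1`, so this product eventually
exceeds `1/2`. -/
lemma eventually_abs_tsum_moebius_le :
    ∀ᶠ s : ℝ in 𝓝[>] 1, |∑' n : ℕ, (μ n : ℝ) * (1 / (n : ℝ) ^ s)| ≤ 2 * (s - 1) := by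
  filter_upwards [tendsto_sub_mul_tsum_nat_rpow.eventually (lt_mem_nhds (by norm_num : (1/2 : ℝ) < 1)),
    self_mem_nhdsWithin] with s h1 hs
  have hs : 1 < s := hs
  have h := tsum_mul_tsum_moebius_rpow hs
  set Z := ∑' n : ℕ, 1 / (n : ℝ) ^ s
  set m := ∑' n : ℕ, (μ n : ℝ) * (1 / (n : ℝ) ^ s)
  have hZ : 0 < Z := by
    by_contra hZ
    nlinarith
  have hm : 0 < m := pos_of_mul_pos_right (by rw [h]; norm_num) hZ.le
  rw [abs_of_pos hm]
  nlinarith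

/-- The difference `⌊u⌋^k - u^k`. -/
def floorDefect (k : ℕ) (u : ℝ) : ℝ := (⌊u⌋₊ : ℝ) ^ k - u ^ k

lemma floorDefect_nonpos {k : ℕ} {u : ℝ} (hu : 0 ≤ u) : floorDefect k u ≤ 0 :=
  sub_nonpos.2 (pow_le_pow_left₀ (by positivity) (Nat.floor_le hu) k)

lemma abs_floorDefect_le_pow {k : ℕ} {u : ℝ} (hu : 0 ≤ u) : |floorDefect k u| ≤ u ^ k := by
  rw [abs_of_nonpos (floorDefect_nonpos hu), floorDefect]
  have : (0 : ℝ) ≤ (⌊u⌋₊ : ℝ) ^ k := by positivity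
  linarith

lemma abs_floorDefect_le_mul_pow {k : ℕ} {u : ℝ} (hu : 0 ≤ u) :
    |floorDefect k u| ≤ k * u ^ (k - 1) := by
  rw [abs_of_nonpos (floorDefect_nonpos hu), floorDefect, neg_sub]
  induction k with
  | zero => simp
  | succ k ih =>
    have h1 := Nat.floor_le hu
    have h2 := Nat.lt_floor_add_one u
    have h3 : (⌊u⌋₊ : ℝ) ^ k ≤ u ^ k := pow_le_pow_left₀ (by positivity) h1 k
    have h4 : u * (k * u ^ (k - 1)) = k * u ^ k := by
      cases k with
      | zero => simp
      | succ k => simp only [Nat.add_sub_cancel]; ring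
    have h5 : (0 : ℝ) ≤ (⌊u⌋₊ : ℝ) ^ k := by positivity
    calc u ^ (k + 1) - (⌊u⌋₊ : ℝ) ^ (k + 1)
        = u * (u ^ k - (⌊u⌋₊ : ℝ) ^ k) + (u - ⌊u⌋₊) * (⌊u⌋₊ : ℝ) ^ k := by ring
      _ ≤ u * (k * u ^ (k - 1)) + 1 * u ^ k := by
        gcongr
        linarith
      _ = _ := by rw [h4, Nat.add_sub_cancel]; push_cast; ring

/-- Interpolates between the bounds `u^k`, better for `u ≤ 1`, and `k u^(k-1)`, better for `u ≥ 1`.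
One exponent `s > k - 1` for all `u` makes the sum over `d` converge at once. -/
lemma abs_floorDefect_le_rpow {k : ℕ} (hk : 1 ≤ k) {s : ℝ} (h1 : (k : ℝ) - 1 ≤ s) (h2 : s ≤ k)
    {u : ℝ} (hu : 0 < u) : |floorDefect k u| ≤ k * u ^ s := by
  have hk' : (1 : ℝ) ≤ k := by exact_mod_cast hk
  rcases le_total u 1 with h | h
  · calc |floorDefect k u| ≤ u ^ k := abs_floorDefect_le_pow hu.le
      _ = u ^ (k : ℝ) := (Real.rpow_natCast _ _).symm
      _ ≤ u ^ s := Real.rpow_le_rpow_of_exponent_ge hu h h2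
      _ ≤ _ := le_mul_of_one_le_left (by positivity) hk'
  · calc |floorDefect k u| ≤ k * u ^ (k - 1) := abs_floorDefect_le_mul_pow hu.le
      _ = k * u ^ ((k - 1 : ℕ) : ℝ) := by rw [Real.rpow_natCast]
      _ ≤ _ := by
        have : ((k - 1 : ℕ) : ℝ) ≤ s := by
          rw [Nat.cast_sub hk]; push_cast; linarith
        gcongr

/-- The error term of the count of coprime points with real side length `x`. -/
def coprimeError (k : ℕ) (x : ℝ) : ℝ := (coprimeCount k ⌊x⌋₊ : ℝ) - x ^ k / zeta k

/-- For `d > ⌊x⌋` the floor vanishes, so the finite Möbius sum is also the infinite one and can be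
subtracted termwise from the series for `x^k/ζ(k)`. -/
lemma hasSum_coprimeError {k : ℕ} (hk : 2 ≤ k) (x : ℝ) :
    HasSum (fun d : ℕ => (μ d : ℝ) * floorDefect k (x / d)) (coprimeError k x) := by
  have h1 : HasSum (fun d : ℕ => (μ d : ℝ) * ((⌊x⌋₊ / d : ℕ) : ℝ) ^ k)
      (coprimeCount k ⌊x⌋₊ : ℝ) := by
    have : (coprimeCount k ⌊x⌋₊ : ℝ) =
        ∑ d ∈ Finset.Icc 1 ⌊x⌋₊, (μ d : ℝ) * ((⌊x⌋₊ / d : ℕ) : ℝ) ^ k := by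
      rw [coprimeCount, Int.cast_sum]
      simp only [Int.cast_mul, Int.cast_pow, Int.cast_natCast]
    rw [this]
    refine hasSum_sum_of_ne_finset_zero fun d hd => ?_
    rcases Nat.eq_zero_or_pos d with rfl | hd0
    · simp
    · have : ⌊x⌋₊ < d := by
        by_contra h
        exact hd (Finset.mem_Icc.2 ⟨hd0, not_lt.1 h⟩)
      rw [Nat.div_eq_of_lt this]
      simp [show k ≠ 0 by omega]
  have h2 : HasSum (fun d : ℕ => (μ d : ℝ) * (1 / (d : ℝ) ^ k) * x ^ k) (1 / zeta k * x ^ k) := by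
    rw [one_div_zeta hk]
    exact (summable_moebius_div_pow hk).hasSum.mul_right _
  have h3 := h1.sub h2
  rw [coprimeError]
  rw [show (fun d : ℕ => (μ d : ℝ) * floorDefect k (x / d)) = fun d : ℕ =>
    (μ d : ℝ) * ((⌊x⌋₊ / d : ℕ) : ℝ) ^ k - (μ d : ℝ) * (1 / (d : ℝ) ^ k) * x ^ k by
      ext d
      rw [floorDefect, Nat.floor_div_natCast, div_pow]
      ring,
    show x ^ k / zeta k = 1 / zeta k * x ^ k by ring]
  exact h3

lemma abs_coprimeError_le {k : ℕ} (hk : 2 ≤ k) {s : ℝ} (h1 : (k : ℝ) - 1 < s) (h2 : s ≤ k) :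
    ∃ C : ℝ, 0 < C ∧ ∀ x : ℝ, 0 < x → |coprimeError k x| ≤ C * x ^ s := by
  have hk' : (2 : ℝ) ≤ k := by exact_mod_cast hk
  have hs : Summable fun d : ℕ => 1 / (d : ℝ) ^ s :=
    Real.summable_one_div_nat_rpow.2 (by linarith)
  have hpos : 0 ≤ ∑' d : ℕ, 1 / (d : ℝ) ^ s := tsum_nonneg fun d => by positivity
  refine ⟨k * (∑' d : ℕ, 1 / (d : ℝ) ^ s) + 1, by positivity, fun x hx => ?_⟩
  have hb : ∀ d : ℕ, ‖(μ d : ℝ) * floorDefect k (x / d)‖ ≤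
      k * x ^ s * (1 / (d : ℝ) ^ s) := fun d => by
    rcases Nat.eq_zero_or_pos d with rfl | hd
    · simp only [ArithmeticFunction.map_zero, Int.cast_zero, zero_mul, norm_zero]
      positivity
    · rw [norm_mul, Real.norm_eq_abs, Real.norm_eq_abs]
      calc |(μ d : ℝ)| * |floorDefect k (x / d)|
          ≤ 1 * (k * (x / d) ^ s) := by
            gcongr
            · exact abs_moebius_cast_le_one d
            · exact abs_floorDefect_le_rpow (by omega) h1.le h2 (by positivity)
        _ = _ := by rw [Real.div_rpow hx.le (by positivity)]; ring
  have := tsum_of_norm_bounded (hs.hasSum.mul_left (k * x ^ s)) hb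
  rw [(hasSum_coprimeError hk x).tsum_eq, Real.norm_eq_abs] at this
  have h0 : 0 ≤ x ^ s := by positivity
  nlinarith

lemma coprimeError_natCast {k : ℕ} (hk : k ≠ 0) (L : ℕ) :
    coprimeError k L = (count (visibleFromOrigin k) L : ℝ) - (L : ℝ) ^ k / zeta k := by
  rw [coprimeError, Nat.floor_natCast, ← count_visibleFromOrigin hk]
  simp

lemma hasAsymptoticDensity_visibleFromOrigin {k : ℕ} (hk : 2 ≤ k) :
    HasAsymptoticDensity (visibleFromOrigin k) (1 / zeta k) := by
  obtain ⟨C, hC, hb⟩ :=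
    abs_coprimeError_le hk (s := (k : ℝ) - 1 / 2) (by linarith) (by linarith)
  rw [HasAsymptoticDensity, tendsto_iff_norm_sub_tendsto_zero]
  have hlim : Tendsto (fun L : ℕ => C * (L : ℝ) ^ (-(1 / 2) : ℝ)) atTop (𝓝 0) := by
    simpa using ((tendsto_rpow_neg_atTop (by norm_num : (0 : ℝ) < 1 / 2)).comp
      tendsto_natCast_atTop_atTop).const_mul C
  refine squeeze_zero' (Eventually.of_forall fun _ => norm_nonneg _) ?_ hlim
  filter_upwards [eventually_gt_atTop 0] with L hL
  have hL' : (0 : ℝ) < L := by exact_mod_cast hL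
  have h := hb L hL'
  rw [coprimeError_natCast (by omega)] at h
  have : (count (visibleFromOrigin k) L : ℝ) / (L : ℝ) ^ k - 1 / zeta k =
      ((count (visibleFromOrigin k) L : ℝ) - (L : ℝ) ^ k / zeta k) / (L : ℝ) ^ k := by
    field_simp
  rw [this, norm_div, Real.norm_eq_abs, Real.norm_of_nonneg (by positivity), div_le_iff₀ (by positivity)]
  refine h.trans (le_of_eq ?_)
  rw [mul_assoc, ← Real.rpow_natCast, ← Real.rpow_add hL']
  congr 2
  ring

/-- An infimum is at most any one of its terms, so a single `L` with negative error suffices. -/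
lemma schnirelmannDensity_lt {k : ℕ}
    (h : IsOmegaMinus (fun L : ℕ => (count (visibleFromOrigin k) L : ℝ) - (L : ℝ) ^ k / zeta k)
      (fun L : ℕ => (L : ℝ) ^ (k - 1))) :
    schnirelmannDensity (visibleFromOrigin k) < 1 / zeta k := by
  obtain ⟨c, hc, hf⟩ := h
  obtain ⟨L, hL, hle⟩ := hf.forall_exists_of_atTop 1
  have hL' : (0 : ℝ) < L := by exact_mod_cast hL
  refine lt_of_le_of_lt (ciInf_le ⟨0, ?_⟩ (⟨L, hL⟩ : {L : ℕ // 0 < L})) ?_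
  · rintro _ ⟨M, rfl⟩
    positivity
  · rw [div_lt_iff₀ (by positivity)]
    have : 0 < c * (L : ℝ) ^ (k - 1) := by positivity
    simp only at hle ⊢
    rw [one_div_mul_eq_div]
    linarith

end LatticeVisibility

end

/-! ### The second-order asymptotic formula for `k ≥ 3` -/

noncomputable section

namespace LatticeVisibility

open scoped ArithmeticFunction.Moebius

/-- With `⌊u⌋ = u - t`, this is the first-order expansion of `(u - t)^k` in `t`; the induction on
`k` multiplies the remainder by `u - t ≤ u` and adds `k u^(k-1) t²`. -/
lemma abs_floorDefect_add_le {k : ℕ} (hk : 2 ≤ k) {u : ℝ} (hu : 0 ≤ u) :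
    |floorDefect k u + k * u ^ (k - 1) * Int.fract u| ≤ k ^ 2 * u ^ (k - 2) := by
  have hfl : (⌊u⌋₊ : ℝ) = u - Int.fract u := by
    rw [← Int.self_sub_floor, sub_sub_cancel, natCast_floor_eq_intCast_floor hu]
  have ht0 := Int.fract_nonneg u
  have ht1 := (Int.fract_lt_one u).le
  have hv0 : 0 ≤ u - Int.fract u := by rw [← hfl]; positivity
  rw [floorDefect, hfl]
  set t := Int.fract u
  induction k, hk using Nat.le_induction with
  | base =>
    have : (u - t) ^ 2 - u ^ 2 + (2 : ℕ) * u ^ (2 - 1) * t = t ^ 2 := by push_cast; ring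
    rw [this, abs_of_nonneg (by positivity)]
    norm_num
    nlinarith
  | succ k hk ih =>
    obtain ⟨m, rfl⟩ := Nat.exists_eq_add_of_le' hk
    simp only [show m + 2 + 1 - 1 = m + 2 by omega, show m + 2 + 1 - 2 = m + 1 by omega,
      show m + 2 - 1 = m + 1 by omega, show m + 2 - 2 = m by omega] at ih ⊢
    have h1 : (u - t) ^ (m + 2 + 1) - u ^ (m + 2 + 1) + ((m + 2 + 1 : ℕ) : ℝ) * u ^ (m + 2) * t =
        (u - t) * ((u - t) ^ (m + 2) - u ^ (m + 2) + ((m + 2 : ℕ) : ℝ) * u ^ (m + 1) * t)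
          + ((m + 2 : ℕ) : ℝ) * u ^ (m + 1) * t ^ 2 := by
      push_cast; ring
    rw [h1]
    have h2 : t ^ 2 ≤ 1 := by nlinarith
    have h3 : 0 ≤ u ^ (m + 1) := by positivity
    calc _ ≤ |(u - t) * ((u - t) ^ (m + 2) - u ^ (m + 2) + ((m + 2 : ℕ) : ℝ) * u ^ (m + 1) * t)|
          + |((m + 2 : ℕ) : ℝ) * u ^ (m + 1) * t ^ 2| := abs_add_le _ _
      _ ≤ u * (((m + 2 : ℕ) : ℝ) ^ 2 * u ^ m) + ((m + 2 : ℕ) : ℝ) * u ^ (m + 1) * 1 := by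
        rw [abs_mul, abs_of_nonneg hv0, abs_of_nonneg (by positivity :
          0 ≤ ((m + 2 : ℕ) : ℝ) * u ^ (m + 1) * t ^ 2)]
        gcongr
        linarith
      _ ≤ _ := by
        push_cast
        have : u * (((m : ℝ) + 2) ^ 2 * u ^ m) = ((m : ℝ) + 2) ^ 2 * u ^ (m + 1) := by ring
        rw [this]
        have hm : (0 : ℝ) ≤ m := by positivity
        nlinarith [mul_nonneg hm h3]

lemma tsum_one_div_sq_tail_le (L : ℕ) :
    Summable (fun i : ℕ => 1 / ((i + (L + 1) : ℕ) : ℝ) ^ 2) ∧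
      ∑' i : ℕ, 1 / ((i + (L + 1) : ℕ) : ℝ) ^ 2 ≤ 2 / ((L : ℝ) + 1) := by
  have hs : Summable (fun i : ℕ => 1 / ((i + (L + 1) : ℕ) : ℝ) ^ 2) :=
    (summable_nat_add_iff (f := fun i : ℕ => 1 / (i : ℝ) ^ 2) (L + 1)).2
      (Real.summable_one_div_nat_pow.2 one_lt_two)
  refine ⟨hs, hs.tsum_le_of_sum_range_le fun n => ?_⟩
  have h := sum_Ioo_inv_sq_le (α := ℝ) L (L + 1 + n)
  refine le_trans (le_of_eq ?_) h
  rw [show Finset.Ioo L (L + 1 + n) = Finset.Ico (L + 1) (L + 1 + n) from rfl,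
    Finset.sum_Ico_eq_sum_range]
  simp [add_comm]

/-- The terms with `d > L` are at most `(L/d)^k ≤ (L/d)²`, and the tail of `∑ 1/d²` is at most
`2/(L+1)`. -/
lemma abs_coprimeError_sub_sum_le {k : ℕ} (hk : 2 ≤ k) (L : ℕ) :
    |coprimeError k L - ∑ d ∈ Finset.Icc 1 L, (μ d : ℝ) * floorDefect k ((L : ℝ) / d)| ≤ 2 * L := by
  have h := hasSum_coprimeError hk L
  have h1 := h.summable.sum_add_tsum_nat_add (L + 1)
  rw [h.tsum_eq] at h1
  have h2 : ∑ d ∈ Finset.range (L + 1), (μ d : ℝ) * floorDefect k ((L : ℝ) / d) =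
      ∑ d ∈ Finset.Icc 1 L, (μ d : ℝ) * floorDefect k ((L : ℝ) / d) := by
    rw [Finset.range_eq_Ico, Finset.sum_eq_sum_Ico_succ_bot (by omega)]
    simp only [ArithmeticFunction.map_zero, Int.cast_zero, zero_mul, zero_add]
    rfl
  rw [← h1, h2, add_sub_cancel_left, ← Real.norm_eq_abs]
  obtain ⟨hs, hle⟩ := tsum_one_div_sq_tail_le L
  refine (tsum_of_norm_bounded (hs.hasSum.mul_left ((L : ℝ) ^ 2)) fun i => ?_).trans ?_
  · have hd : (0 : ℝ) < ((i + (L + 1) : ℕ) : ℝ) := by positivity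
    have hle1 : (L : ℝ) / ((i + (L + 1) : ℕ) : ℝ) ≤ 1 := by
      rw [div_le_one hd]
      exact_mod_cast (by omega : L ≤ i + (L + 1))
    rw [norm_mul, Real.norm_eq_abs, Real.norm_eq_abs]
    calc _ ≤ 1 * ((L : ℝ) / ((i + (L + 1) : ℕ) : ℝ)) ^ k := by
          gcongr
          · exact abs_moebius_cast_le_one _
          · exact abs_floorDefect_le_pow (by positivity)
      _ ≤ ((L : ℝ) / ((i + (L + 1) : ℕ) : ℝ)) ^ 2 := by
          rw [one_mul]
          exact pow_le_pow_of_le_one (by positivity) hle1 hk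
      _ = _ := by rw [div_pow]; ring
  · refine (mul_le_mul_of_nonneg_left hle (by positivity)).trans ?_
    rw [← mul_div_assoc, div_le_iff₀ (by positivity)]
    nlinarith [(Nat.cast_nonneg L : (0 : ℝ) ≤ L)]

lemma sum_div_pow_le {k : ℕ} (hk : 3 ≤ k) (L : ℕ) :
    ∑ d ∈ Finset.Icc 1 L, ((L : ℝ) / d) ^ (k - 2) ≤ (L : ℝ) ^ (k - 2) * (1 + Real.log L) := by
  have h := harmonic_le_one_add_log L
  rw [harmonic_eq_sum_Icc] at h
  push_cast at h
  calc _ ≤ ∑ d ∈ Finset.Icc 1 L, (L : ℝ) ^ (k - 2) * (d : ℝ)⁻¹ := by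
        refine Finset.sum_le_sum fun d hd => ?_
        have hd1 : (1 : ℝ) ≤ d := by exact_mod_cast (Finset.mem_Icc.1 hd).1
        rw [div_pow, div_eq_mul_inv]
        gcongr
        exact le_self_pow₀ hd1 (by omega)
    _ ≤ _ := by rw [← Finset.mul_sum]; gcongr

lemma coprimeError_add_fracSum_isBigO {k : ℕ} (hk : 3 ≤ k) :
    (fun L : ℕ => (count (visibleFromOrigin k) L : ℝ)
        - ((L : ℝ) ^ k / zeta k - (k : ℝ) * fracSum k L * (L : ℝ) ^ (k - 1)))
      =O[atTop] (fun L : ℕ => (L : ℝ) ^ (k - 2) * Real.log (L : ℝ)) := by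
  refine IsBigO.of_bound (2 * k ^ 2 + 2) ?_
  -- From `L ≥ 3 > e` one gets `log L ≥ 1`, which absorbs both the `1` in the harmonic bound and the
  -- tail `2L ≤ 2 L^(k-2) log L`.
  filter_upwards [eventually_ge_atTop 3] with L hL
  have hL3 : (3 : ℝ) ≤ L := by exact_mod_cast hL
  have hlog : 1 ≤ Real.log L := by
    rw [Real.le_log_iff_exp_le (by linarith)]
    exact Real.exp_one_lt_d9.le.trans (by linarith)
  have hsum : (k : ℝ) * fracSum k L * (L : ℝ) ^ (k - 1) =
      ∑ d ∈ Finset.Icc 1 L, (μ d : ℝ) * (k * ((L : ℝ) / d) ^ (k - 1) * Int.fract ((L : ℝ) / d)) := by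
    rw [fracSum, Finset.mul_sum, Finset.sum_mul]
    refine Finset.sum_congr rfl fun d _ => ?_
    rw [div_pow]
    ring
  have h1 := abs_coprimeError_sub_sum_le (by omega : 2 ≤ k) L
  have h2 : |(∑ d ∈ Finset.Icc 1 L, (μ d : ℝ) * floorDefect k ((L : ℝ) / d))
      + (k : ℝ) * fracSum k L * (L : ℝ) ^ (k - 1)| ≤
      k ^ 2 * ((L : ℝ) ^ (k - 2) * (1 + Real.log L)) := by
    rw [hsum, ← Finset.sum_add_distrib]
    refine (Finset.abs_sum_le_sum_abs _ _).trans ?_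
    calc _ ≤ ∑ d ∈ Finset.Icc 1 L, (k : ℝ) ^ 2 * ((L : ℝ) / d) ^ (k - 2) := by
          refine Finset.sum_le_sum fun d _ => ?_
          rw [← mul_add, abs_mul]
          calc _ ≤ 1 * ((k : ℝ) ^ 2 * ((L : ℝ) / d) ^ (k - 2)) := by
                gcongr
                · exact abs_moebius_cast_le_one d
                · exact abs_floorDefect_add_le (by omega) (by positivity)
            _ = _ := one_mul _
      _ ≤ _ := by
        rw [← Finset.mul_sum]
        gcongr
        exact sum_div_pow_le hk L
  have h3 : (count (visibleFromOrigin k) L : ℝ)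
        - ((L : ℝ) ^ k / zeta k - (k : ℝ) * fracSum k L * (L : ℝ) ^ (k - 1)) =
      (coprimeError k L - ∑ d ∈ Finset.Icc 1 L, (μ d : ℝ) * floorDefect k ((L : ℝ) / d)) +
      ((∑ d ∈ Finset.Icc 1 L, (μ d : ℝ) * floorDefect k ((L : ℝ) / d))
      + (k : ℝ) * fracSum k L * (L : ℝ) ^ (k - 1)) := by
    rw [coprimeError_natCast (by omega)]; ring
  have hP : (L : ℝ) ≤ (L : ℝ) ^ (k - 2) := le_self_pow₀ (by linarith) (by omega)
  have hP0 : (0 : ℝ) < (L : ℝ) ^ (k - 2) := by positivity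
  rw [h3, Real.norm_eq_abs, Real.norm_of_nonneg (by positivity)]
  calc _ ≤ _ := abs_add_le _ _
    _ ≤ 2 * L + k ^ 2 * ((L : ℝ) ^ (k - 2) * (1 + Real.log L)) := add_le_add h1 h2
    _ ≤ 2 * ((L : ℝ) ^ (k - 2) * Real.log L) +
        k ^ 2 * ((L : ℝ) ^ (k - 2) * (Real.log L + Real.log L)) := by
      gcongr
      nlinarith
    _ = _ := by ring

end LatticeVisibility

end

/-! ### Oscillation for `k ≥ 3`: limits along sequences with stable residues -/

noncomputable section

namespace LatticeVisibility

open scoped ArithmeticFunction.Moebius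

lemma tendsto_floorDefect_div {k : ℕ} (hk : 2 ≤ k) {L : ℕ → ℕ} (hL : Tendsto L atTop atTop)
    {d r : ℕ} (hd : 0 < d) (hr : ∀ᶠ n in atTop, L n % d = r) :
    Tendsto (fun n => floorDefect k ((L n : ℝ) / d) / (L n : ℝ) ^ (k - 1)) atTop
      (𝓝 (-k * (r / (d : ℝ) ^ k))) := by
  rw [tendsto_iff_norm_sub_tendsto_zero]
  have hlim : Tendsto (fun n => (k : ℝ) ^ 2 * (L n : ℝ)⁻¹) atTop (𝓝 0) := by
    simpa using ((tendsto_inv_atTop_zero.comp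
      (tendsto_natCast_atTop_atTop (R := ℝ))).comp hL).const_mul ((k : ℝ) ^ 2)
  refine squeeze_zero' (Eventually.of_forall fun _ => norm_nonneg _) ?_ hlim
  filter_upwards [hr, hL.eventually_gt_atTop 0] with n hn hn0
  have hn0' : (0 : ℝ) < L n := by exact_mod_cast hn0
  have hd' : (1 : ℝ) ≤ d := by exact_mod_cast hd
  have h := abs_floorDefect_add_le hk (u := (L n : ℝ) / d) (by positivity)
  rw [Int.fract_div_natCast_eq_div_natCast_mod, hn] at h
  obtain ⟨m, rfl⟩ := Nat.exists_eq_add_of_le' hk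
  simp only [show m + 2 - 1 = m + 1 by omega, show m + 2 - 2 = m by omega] at h ⊢
  have h1 : floorDefect (m + 2) ((L n : ℝ) / d) / (L n : ℝ) ^ (m + 1) -
      -((m + 2 : ℕ) : ℝ) * (r / (d : ℝ) ^ (m + 2)) =
      (floorDefect (m + 2) ((L n : ℝ) / d) +
        ((m + 2 : ℕ) : ℝ) * ((L n : ℝ) / d) ^ (m + 1) * (r / d)) / (L n : ℝ) ^ (m + 1) := by
    have hd0 : (d : ℝ) ≠ 0 := by positivity
    rw [add_div, div_pow]
    have : ((m + 2 : ℕ) : ℝ) * ((L n : ℝ) ^ (m + 1) / (d : ℝ) ^ (m + 1)) * (r / d) /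
        (L n : ℝ) ^ (m + 1) = ((m + 2 : ℕ) : ℝ) * (r / (d : ℝ) ^ (m + 2)) := by
      rw [pow_succ (d : ℝ) (m + 1)]
      field_simp
    rw [this]
    ring
  rw [h1, norm_div, Real.norm_eq_abs, Real.norm_of_nonneg (by positivity),
    div_le_iff₀ (by positivity)]
  calc _ ≤ _ := h
    _ ≤ ((m + 2 : ℕ) : ℝ) ^ 2 * (L n : ℝ) ^ m := by
      gcongr
      exact div_le_self hn0'.le hd'
    _ = _ := by rw [pow_succ (L n : ℝ) m]; field_simp

/-- Dominated convergence with majorant `k/d^(k-1)`, summable only because `k ≥ 3`. Residues modulo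
non-squarefree `d` are irrelevant since `μ(d) = 0`. -/
lemma tendsto_coprimeError_div {k : ℕ} (hk : 3 ≤ k) {L r : ℕ → ℕ} (hL : Tendsto L atTop atTop)
    (hr : ∀ d, μ d ≠ 0 → ∀ᶠ n in atTop, L n % d = r d) :
    Tendsto (fun n => coprimeError k (L n) / (L n : ℝ) ^ (k - 1)) atTop
      (𝓝 (-k * ∑' d : ℕ, (μ d : ℝ) * (r d / (d : ℝ) ^ k))) := by
  have hs : Summable fun d : ℕ => (k : ℝ) * (1 / (d : ℝ) ^ (k - 1)) :=
    (Real.summable_one_div_nat_pow.2 (by omega)).mul_left _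
  have key := tendsto_tsum_of_dominated_convergence
    (f := fun n d => (μ d : ℝ) * floorDefect k ((L n : ℝ) / d) / (L n : ℝ) ^ (k - 1))
    (g := fun d : ℕ => (μ d : ℝ) * (-k * (r d / (d : ℝ) ^ k))) (𝓕 := atTop) hs ?_ ?_
  · refine (key.congr fun n => ?_).trans (le_of_eq ?_)
    · rw [tsum_div_const, (hasSum_coprimeError (by omega) _).tsum_eq]
    · rw [← tsum_mul_left]
      congr 2
      ext d
      ring
  · intro d
    by_cases hd : μ d = 0
    · simp [hd]
    · have hd0 : 0 < d := Nat.pos_of_ne_zero fun h => hd (by simp [h])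
      simp_rw [mul_div_assoc]
      exact (tendsto_floorDefect_div (by omega) hL hd0 (hr d hd)).const_mul _
  · filter_upwards [hL.eventually_gt_atTop 0] with n hn d
    have hn0 : (0 : ℝ) < L n := by exact_mod_cast hn
    rw [norm_div, norm_mul, Real.norm_of_nonneg (by positivity : 0 ≤ (L n : ℝ) ^ (k - 1)),
      Real.norm_eq_abs, Real.norm_eq_abs, div_le_iff₀ (by positivity)]
    calc _ ≤ 1 * (k * ((L n : ℝ) / d) ^ (k - 1)) := by
          gcongr
          · exact abs_moebius_cast_le_one d
          · exact abs_floorDefect_le_mul_pow (by positivity)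
      _ = _ := by rw [div_pow]; ring

lemma isOmegaPlus_of_tendsto {k : ℕ} (hk : k ≠ 0) {L : ℕ → ℕ} (hL : Tendsto L atTop atTop) {a : ℝ}
    (ha : 0 < a) (h : Tendsto (fun n => coprimeError k (L n) / (L n : ℝ) ^ (k - 1)) atTop (𝓝 a)) :
    IsOmegaPlus (fun L : ℕ => (count (visibleFromOrigin k) L : ℝ) - (L : ℝ) ^ k / zeta k)
      (fun L : ℕ => (L : ℝ) ^ (k - 1)) := by
  refine ⟨a / 2, by positivity, hL.frequently (Eventually.frequently ?_)⟩
  filter_upwards [h.eventually (lt_mem_nhds (half_lt_self ha)), hL.eventually_gt_atTop 0]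
    with n hn hn0
  have hn0' : (0 : ℝ) < L n := by exact_mod_cast hn0
  rw [lt_div_iff₀ (by positivity), coprimeError_natCast hk] at hn
  exact hn.le

lemma isOmegaMinus_of_tendsto {k : ℕ} (hk : k ≠ 0) {L : ℕ → ℕ} (hL : Tendsto L atTop atTop) {a : ℝ}
    (ha : a < 0) (h : Tendsto (fun n => coprimeError k (L n) / (L n : ℝ) ^ (k - 1)) atTop (𝓝 a)) :
    IsOmegaMinus (fun L : ℕ => (count (visibleFromOrigin k) L : ℝ) - (L : ℝ) ^ k / zeta k)
      (fun L : ℕ => (L : ℝ) ^ (k - 1)) := by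
  refine ⟨-a / 2, by linarith, hL.frequently (Eventually.frequently ?_)⟩
  filter_upwards [h.eventually (gt_mem_nhds (by linarith : a < a / 2)), hL.eventually_gt_atTop 0]
    with n hn hn0
  have hn0' : (0 : ℝ) < L n := by exact_mod_cast hn0
  rw [div_lt_iff₀ (by positivity), coprimeError_natCast hk] at hn
  refine hn.le.trans (le_of_eq (by ring))

lemma one_div_zeta_sub_one {k : ℕ} (hk : 2 ≤ k) :
    1 / zeta k - 1 = ∑' d : ℕ, (μ d : ℝ) * ((if d = 1 then 0 else 1) / (d : ℝ) ^ k) := by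
  have h := (summable_moebius_div_pow hk).hasSum
  rw [← one_div_zeta hk] at h
  have h1 := h.sub (hasSum_ite_eq (1 : ℕ) (1 : ℝ))
  rw [← h1.tsum_eq]
  refine tsum_congr fun d => ?_
  split_ifs with hd
  · simp [hd]
  · simp

lemma isOmegaPlus_of_three_le {k : ℕ} (hk : 3 ≤ k) :
    IsOmegaPlus (fun L : ℕ => (count (visibleFromOrigin k) L : ℝ) - (L : ℝ) ^ k / zeta k)
      (fun L : ℕ => (L : ℝ) ^ (k - 1)) := by
  -- `n! + 1` eventually leaves residue `1` modulo every `d > 1` and `0` modulo `1`, so the limit is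
  -- `k(1 - 1/ζ(k))`.
  have hL : Tendsto (fun n : ℕ => n.factorial + 1) atTop atTop :=
    tendsto_atTop_mono (fun n => (Nat.self_le_factorial n).trans (Nat.le_succ _)) tendsto_id
  have h := tendsto_coprimeError_div hk (r := fun d => if d = 1 then 0 else 1) hL fun d hd => by
    have hd0 : 0 < d := Nat.pos_of_ne_zero fun h => hd (by simp [h])
    filter_upwards [eventually_ge_atTop d] with n hn
    split_ifs with h1
    · rw [h1, Nat.mod_one]
    · rw [Nat.add_mod, Nat.mod_eq_zero_of_dvd (Nat.dvd_factorial hd0 hn), zero_add, Nat.mod_mod,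
        Nat.mod_eq_of_lt (by omega)]
  refine isOmegaPlus_of_tendsto (by omega) hL ?_ h
  have h2 := one_div_zeta_sub_one (by omega : 2 ≤ k)
  push_cast
  rw [← h2]
  have hz := one_lt_zeta (by omega : 2 ≤ k)
  have : 1 / zeta k < 1 := (div_lt_one (by linarith)).2 hz
  have hk' : (0 : ℝ) < k := by exact_mod_cast (by omega : 0 < k)
  nlinarith

/-- A number prime to `p`, divisible by every `m ≤ n` prime to `p`, and congruent to `1`
modulo `p` when `p` is prime. -/
def smoothPow (p n : ℕ) : ℕ :=
  ((∏ m ∈ (Finset.range (n + 1)).filter (¬ p ∣ ·), m) * (p * n + 1)) ^ (p - 1)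

lemma tendsto_smoothPow {p : ℕ} (hp : p.Prime) : Tendsto (smoothPow p) atTop atTop := by
  refine tendsto_atTop_mono (fun n => ?_) tendsto_id
  have h1 : 1 ≤ ∏ m ∈ (Finset.range (n + 1)).filter (¬ p ∣ ·), m := by
    refine Finset.one_le_prod' fun m hm => ?_
    have := (Finset.mem_filter.1 hm).2
    exact Nat.pos_of_ne_zero fun h => this (h ▸ dvd_zero p)
  have h2 := hp.two_le
  rw [smoothPow]
  refine le_trans ?_ (Nat.le_self_pow (by omega) _)
  calc n ≤ p * n + 1 := by nlinarith
    _ ≤ _ := Nat.le_mul_of_pos_left _ h1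

/-- Writing the base as `m w`, the number is `m · m^(p-2) · w^(p-1)` with `w^(p-1) ≡ 1` modulo `p`
by Fermat. Here `m^(p-2)` serves as the inverse of `m` modulo `p`. -/
lemma smoothPow_mod {p : ℕ} (hp : p.Prime) {m n : ℕ} (hm : ¬ p ∣ m) (hmn : m ≤ n) :
    smoothPow p n % m = 0 ∧ smoothPow p n % (p * m) = m * (m ^ (p - 2) % p) := by
  have h2 := hp.two_le
  set W := (∏ m ∈ (Finset.range (n + 1)).filter (¬ p ∣ ·), m) * (p * n + 1) with hW
  have hmW : m ∣ W := Dvd.dvd.mul_right (Finset.dvd_prod_of_mem _ (by simp [hm]; omega)) _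
  have hpW : ¬ p ∣ W := by
    rw [hW, hp.dvd_mul, hp.prime.dvd_finsetProd_iff]
    rintro (⟨a, ha, h⟩ | h)
    · exact (Finset.mem_filter.1 ha).2 h
    · have := (Nat.dvd_add_right (dvd_mul_right p n)).1 h
      exact hp.one_lt.ne' (Nat.dvd_one.1 this)
  have hsp : smoothPow p n = W ^ (p - 1) := rfl
  refine ⟨Nat.mod_eq_zero_of_dvd (hmW.trans (dvd_pow_self _ (by omega))), ?_⟩
  obtain ⟨w, hw⟩ := hmW
  have hpw : Nat.Coprime w p :=
    ((Nat.Prime.coprime_iff_not_dvd hp).2 fun h => hpW (hw ▸ h.mul_left m)).symm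
  have hf : w ^ (p - 1) ≡ 1 [MOD p] := by
    simpa [Nat.totient_prime hp] using Nat.ModEq.pow_totient hpw
  rw [hsp, hw, mul_comm p m, mul_pow, show m ^ (p - 1) = m * m ^ (p - 2) by
    rw [← pow_succ']; congr 1; omega, mul_assoc, Nat.mul_mod_mul_left]
  congr 1
  have := hf.mul_left (m ^ (p - 2))
  rwa [mul_one] at this

/-- If `p + 1 = m q`, then `m q ≡ 1` modulo `p`, and `m ≥ 2` forces `q < p`, so `q` is the reduced
inverse. -/
lemma inverse_mod_of_dvd_add_one {p m : ℕ} (hp : p.Prime) (hm : 2 ≤ m) (hmp : m < p)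
    (h : m ∣ p + 1) : ((m ^ (p - 2) % p : ℕ) : ℝ) = (p + 1) / m := by
  obtain ⟨q, hq⟩ := h
  have h2 := hp.two_le
  have hqp : q < p := by nlinarith
  have hc : Nat.Coprime m p :=
    ((Nat.Prime.coprime_iff_not_dvd hp).2 fun h => absurd (Nat.le_of_dvd (by omega) h)
      (by omega)).symm
  have hf : m ^ (p - 1) ≡ 1 [MOD p] := by
    simpa [Nat.totient_prime hp] using Nat.ModEq.pow_totient hc
  have h1 : m ^ (p - 2) ≡ q [MOD p] := by
    have e1 : m ^ (p - 2) * (p + 1) = m ^ (p - 1) * q := by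
      rw [hq, ← mul_assoc, ← pow_succ]; congr 2; omega
    have e2 : m ^ (p - 2) * (p + 1) ≡ m ^ (p - 2) [MOD p] := by
      have : p + 1 ≡ 1 [MOD p] := by simp [Nat.ModEq]
      simpa using this.mul_left (m ^ (p - 2))
    have e3 : m ^ (p - 1) * q ≡ q [MOD p] := by simpa using hf.mul_right q
    exact e2.symm.trans (e1 ▸ e3)
  have h3 : m ^ (p - 2) % p = q := Eq.trans h1 (Nat.mod_eq_of_lt hqp)
  have hm0 : (m : ℝ) ≠ 0 := by exact_mod_cast (by omega : m ≠ 0)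
  rw [h3, eq_div_iff hm0]
  have : ((p + 1 : ℕ) : ℝ) = ((m * q : ℕ) : ℝ) := by rw [hq]
  push_cast at this
  linarith

/-- The sum `∑_{p ∤ m} μ(m) m^{1-k} {m⁻¹ / p}` with `m⁻¹` the inverse of `m` modulo `p`. -/
def inverseSum (k p : ℕ) : ℝ :=
  ∑' m : ℕ, (μ m : ℝ) *
    if p ∣ m then 0 else ((m ^ (p - 2) % p : ℕ) : ℝ) / p / (m : ℝ) ^ (k - 1)

/-- Along primes `p ≡ -1` modulo `N!`, the fraction `{m⁻¹/p}` tends to `1/m` for each `m ≥ 2` but to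
`0` for `m = 1`. The sum therefore tends to `1/ζ(k)` without its leading term `1`, which is
negative. -/
lemma exists_prime_inverseSum_neg {k : ℕ} (hk : 3 ≤ k) :
    ∃ p : ℕ, p.Prime ∧ inverseSum k p < 0 := by
  -- Dirichlet's theorem on primes in arithmetic progressions.
  have hD : ∀ N : ℕ, ∃ p > N, p.Prime ∧ (p : ZMod N.factorial) = -1 := fun N => by
    have : NeZero N.factorial := ⟨N.factorial_ne_zero⟩
    exact Nat.forall_exists_prime_gt_and_eq_mod isUnit_one.neg N
  choose p hpN hp hmod using hD
  have hdvd : ∀ N m, 0 < m → m ≤ N → m ∣ p N + 1 := fun N m hm hmN => by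
    refine (Nat.dvd_factorial hm hmN).trans ?_
    rw [← ZMod.natCast_eq_zero_iff]
    push_cast
    rw [hmod N, neg_add_cancel]
  have hptop : Tendsto (fun N => (p N : ℝ)) atTop atTop :=
    tendsto_natCast_atTop_atTop.comp (tendsto_atTop_mono (fun N => (hpN N).le) tendsto_id)
  have hs : Summable fun m : ℕ => 1 / (m : ℝ) ^ (k - 1) :=
    Real.summable_one_div_nat_pow.2 (by omega)
  have key : Tendsto (fun N => inverseSum k (p N)) atTop
      (𝓝 (∑' d : ℕ, (μ d : ℝ) * ((if d = 1 then 0 else 1) / (d : ℝ) ^ k))) := by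
    refine tendsto_tsum_of_dominated_convergence hs (fun m => ?_)
      (Eventually.of_forall fun N m => ?_)
    · refine Tendsto.const_mul _ ?_
      rcases Nat.eq_zero_or_pos m with rfl | hm
      · simp [show k ≠ 0 by omega]
      have hev : ∀ᶠ N in atTop, ¬ p N ∣ m := by
        filter_upwards [eventually_ge_atTop m] with N hN h
        have := Nat.le_of_dvd hm h
        have := hpN N
        omega
      rcases eq_or_ne m 1 with rfl | hm1
      · have : Tendsto (fun N => (p N : ℝ)⁻¹) atTop (𝓝 0) := tendsto_inv_atTop_zero.comp hptop
        simp only [if_true, zero_div]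
        refine this.congr' ?_
        filter_upwards [hev] with N hN
        rw [if_neg hN, one_pow, Nat.mod_eq_of_lt (hp N).one_lt]
        simp
      · have : Tendsto (fun N => (1 + (p N : ℝ)⁻¹) * (1 / (m : ℝ) ^ k)) atTop
            (𝓝 ((1 + 0) * (1 / (m : ℝ) ^ k))) :=
          ((tendsto_inv_atTop_zero.comp hptop).const_add 1).mul_const _
        rw [if_neg hm1]
        simp only [add_zero, one_mul] at this
        refine this.congr' ?_
        filter_upwards [hev, eventually_ge_atTop m] with N hN hmN
        have hp0 : (0 : ℝ) < p N := by exact_mod_cast (hp N).pos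
        have hm0 : (0 : ℝ) < m := by exact_mod_cast hm
        rw [if_neg hN, inverse_mod_of_dvd_add_one (hp N) (by omega)
          (hmN.trans_lt (hpN N)) (hdvd N m hm hmN)]
        rw [show (m : ℝ) ^ k = m * (m : ℝ) ^ (k - 1) by rw [← pow_succ']; congr 1; omega]
        field_simp
    · have hp0 : (0 : ℝ) < p N := by exact_mod_cast (hp N).pos
      rw [norm_mul, Real.norm_eq_abs]
      calc _ ≤ 1 * (1 / (m : ℝ) ^ (k - 1)) := by
            gcongr
            · exact abs_moebius_cast_le_one m
            · split_ifs with h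
              · rw [norm_zero]; positivity
              · rw [Real.norm_of_nonneg (by positivity)]
                gcongr
                rw [div_le_one hp0]
                exact_mod_cast (Nat.mod_lt _ (hp N).pos).le
        _ = _ := one_mul _
  rw [← one_div_zeta_sub_one (by omega)] at key
  have hz := one_lt_zeta (by omega : 2 ≤ k)
  have : 1 / zeta k < 1 := (div_lt_one (by linarith)).2 hz
  obtain ⟨N, hN⟩ := (key.eventually (gt_mem_nhds (by linarith : 1 / zeta k - 1 < 0))).exists
  exact ⟨p N, hp N, hN⟩

lemma isOmegaMinus_of_three_le {k : ℕ} (hk : 3 ≤ k) :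
    IsOmegaMinus (fun L : ℕ => (count (visibleFromOrigin k) L : ℝ) - (L : ℝ) ^ k / zeta k)
      (fun L : ℕ => (L : ℝ) ^ (k - 1)) := by
  obtain ⟨p, hp, hneg⟩ := exists_prime_inverseSum_neg hk
  have hp0 : (0 : ℝ) < p := by exact_mod_cast hp.pos
  set r : ℕ → ℕ := fun d => if p ∣ d then d / p * ((d / p) ^ (p - 2) % p) else 0 with hr
  have hL := tendsto_smoothPow hp
  have hμ : ∀ m, p ∣ m → μ (p * m) = 0 := fun m hm =>
    ArithmeticFunction.moebius_eq_zero_of_not_squarefree fun h =>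
      hp.prime.not_isUnit (h p (Nat.mul_dvd_mul_left p hm))
  have h := tendsto_coprimeError_div hk (r := r) hL fun d hd => by
    by_cases hpd : p ∣ d
    · obtain ⟨m, rfl⟩ := hpd
      have hm : ¬ p ∣ m := fun h => hd (hμ m h)
      filter_upwards [eventually_ge_atTop m] with n hn
      rw [(smoothPow_mod hp hm hn).2]
      simp [hr, Nat.mul_div_cancel_left m hp.pos]
    · filter_upwards [eventually_ge_atTop d] with n hn
      rw [(smoothPow_mod hp hpd hn).1]
      simp [hr, hpd]
  -- Only `d = p m` with `p ∤ m` survive; the sign comes from `μ(p m) = -μ(m)`.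
  have hsum : ∑' d : ℕ, (μ d : ℝ) * (r d / (d : ℝ) ^ k) =
      -(1 / (p : ℝ) ^ (k - 1)) * inverseSum k p := by
    have hinj : Function.Injective (fun m : ℕ => p * m) := fun a b hab =>
      Nat.eq_of_mul_eq_mul_left hp.pos hab
    rw [← hinj.tsum_eq (f := fun d : ℕ => (μ d : ℝ) * (r d / (d : ℝ) ^ k)), inverseSum,
      ← tsum_mul_left]
    · refine tsum_congr fun m => ?_
      by_cases hm : p ∣ m
      · simp [hμ m hm, hm]
      · have hc : Nat.Coprime p m := (Nat.Prime.coprime_iff_not_dvd hp).2 hm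
        have hm0 : (0 : ℝ) < m := by
          have : 0 < m := Nat.pos_of_ne_zero fun h => hm (h ▸ dvd_zero p)
          exact_mod_cast this
        rw [ArithmeticFunction.isMultiplicative_moebius.map_mul_of_coprime hc,
          ArithmeticFunction.moebius_apply_prime hp]
        simp only [hr, dvd_mul_right, if_true, Nat.mul_div_cancel_left m hp.pos, hm, if_false]
        push_cast
        obtain ⟨j, rfl⟩ := Nat.exists_eq_add_of_le' (by omega : 1 ≤ k)
        rw [Nat.add_sub_cancel, mul_pow, pow_succ, pow_succ]
        field_simp
    · intro d hd
      by_contra hnot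
      apply hd
      have : ¬ p ∣ d := fun ⟨m, hm⟩ => hnot ⟨m, hm.symm⟩
      simp [hr, this]
  rw [hsum] at h
  refine isOmegaMinus_of_tendsto (by omega) hL ?_ h
  have hk' : (0 : ℝ) < k := by exact_mod_cast (by omega : 0 < k)
  have h1 : 0 < (k : ℝ) * (1 / (p : ℝ) ^ (k - 1)) := by positivity
  nlinarith

end LatticeVisibility

end

/-! ### The case `k = 2`: the Mellin transform of the error stays bounded near `1` -/

noncomputable section

namespace LatticeVisibility

open scoped ArithmeticFunction.Moebius

open MeasureTheory Set

/-- The integrand of the Mellin transform of `⌊u⌋^2 - u^2`. -/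
def defectKernel (σ u : ℝ) : ℝ := floorDefect 2 u * u ^ (-1 - σ)

lemma measurable_floorDefect (k : ℕ) : Measurable (floorDefect k) := by
  unfold floorDefect
  have : Measurable fun u : ℝ => (⌊u⌋₊ : ℝ) := measurable_from_nat.comp Nat.measurable_floor
  fun_prop

lemma measurable_defectKernel (σ : ℝ) : Measurable (defectKernel σ) := by
  unfold defectKernel
  have := measurable_floorDefect 2
  fun_prop

lemma abs_defectKernel_le_left {σ u : ℝ} (hu : 0 < u) : ‖defectKernel σ u‖ ≤ u ^ (1 - σ) := by
  rw [defectKernel, norm_mul, Real.norm_eq_abs, Real.norm_of_nonneg (by positivity)]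
  calc _ ≤ u ^ 2 * u ^ (-1 - σ) := by
        gcongr
        exact abs_floorDefect_le_pow hu.le
    _ = _ := by
      rw [← Real.rpow_natCast, ← Real.rpow_add hu]
      congr 1
      push_cast
      ring

lemma abs_defectKernel_le_right {σ u : ℝ} (hu : 0 < u) : ‖defectKernel σ u‖ ≤ 2 * u ^ (-σ) := by
  rw [defectKernel, norm_mul, Real.norm_eq_abs, Real.norm_of_nonneg (by positivity)]
  calc _ ≤ (2 * u) * u ^ (-1 - σ) := by
        gcongr
        simpa using abs_floorDefect_le_mul_pow (k := 2) hu.le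
    _ = 2 * (u ^ (1 : ℝ) * u ^ (-1 - σ)) := by rw [Real.rpow_one]; ring
    _ = _ := by
      rw [← Real.rpow_add hu]
      congr 2
      ring

lemma integrableOn_defectKernel {σ : ℝ} (h1 : 1 < σ) (h2 : σ ≤ 3 / 2) :
    IntegrableOn (defectKernel σ) (Ioi 0) ∧ ∫ u in Ioi 0, ‖defectKernel σ u‖ ≤ 3 / (σ - 1) := by
  have i1 : IntegrableOn (fun u : ℝ => u ^ (1 - σ)) (Ioc 0 1) := by
    rw [← intervalIntegrable_iff_integrableOn_Ioc_of_le zero_le_one]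
    exact intervalIntegral.intervalIntegrable_rpow' (by linarith)
  have i2 : IntegrableOn (fun u : ℝ => 2 * u ^ (-σ)) (Ioi 1) :=
    (integrableOn_Ioi_rpow_of_lt (by linarith) one_pos).const_mul 2
  have b1 : ∀ᵐ u ∂volume.restrict (Ioc (0 : ℝ) 1), ‖defectKernel σ u‖ ≤ u ^ (1 - σ) :=
    (ae_restrict_mem measurableSet_Ioc).mono fun u hu => abs_defectKernel_le_left hu.1
  have b2 : ∀ᵐ u ∂volume.restrict (Ioi (1 : ℝ)), ‖defectKernel σ u‖ ≤ 2 * u ^ (-σ) :=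
    (ae_restrict_mem measurableSet_Ioi).mono fun u hu =>
      abs_defectKernel_le_right (one_pos.trans hu)
  have j1 : IntegrableOn (defectKernel σ) (Ioc 0 1) :=
    Integrable.mono' i1 (measurable_defectKernel σ).aestronglyMeasurable b1
  have j2 : IntegrableOn (defectKernel σ) (Ioi 1) :=
    Integrable.mono' i2 (measurable_defectKernel σ).aestronglyMeasurable b2
  have hU : Ioc (0 : ℝ) 1 ∪ Ioi 1 = Ioi 0 := Ioc_union_Ioi_eq_Ioi zero_le_one
  refine ⟨hU ▸ j1.union j2, ?_⟩
  rw [← hU, setIntegral_union Ioc_disjoint_Ioi_same measurableSet_Ioi j1.norm j2.norm]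
  have e1 : ∫ u in Ioc (0 : ℝ) 1, ‖defectKernel σ u‖ ≤ 1 / (2 - σ) := by
    refine (integral_mono_ae j1.norm i1 b1).trans (le_of_eq ?_)
    rw [← intervalIntegral.integral_of_le zero_le_one, integral_rpow (Or.inl (by linarith)),
      Real.one_rpow, Real.zero_rpow (by linarith)]
    congr 1 <;> ring
  have e2 : ∫ u in Ioi (1 : ℝ), ‖defectKernel σ u‖ ≤ 2 / (σ - 1) := by
    refine (integral_mono_ae j2.norm i2 b2).trans (le_of_eq ?_)
    rw [integral_const_mul, integral_Ioi_rpow_of_lt (by linarith) one_pos, Real.one_rpow]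
    rw [show -σ + 1 = -(σ - 1) by ring, neg_div_neg_eq, mul_one_div]
  -- This is where `σ ≤ 3/2` is needed: the part near `0` is then no larger than the pole at `σ =
  -- 1`.
  have e3 : 1 / (2 - σ) ≤ 1 / (σ - 1) := one_div_le_one_div_of_le (by linarith) (by linarith)
  calc _ ≤ 1 / (σ - 1) + 2 / (σ - 1) := by linarith
    _ = _ := by ring

lemma defectKernel_mul_inv {σ x : ℝ} (hx : 0 < x) {d : ℕ} (hd : 0 < d) :
    floorDefect 2 (x / d) * x ^ (-1 - σ) =
      (d : ℝ) ^ (-1 - σ) * defectKernel σ (x * (d : ℝ)⁻¹) := by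
  have hd' : (0 : ℝ) < d := by exact_mod_cast hd
  rw [defectKernel, ← div_eq_mul_inv, Real.div_rpow hx.le hd'.le]
  have : (d : ℝ) ^ (-1 - σ) ≠ 0 := by positivity
  field_simp

/-- The substitution `x = d u` turns the `d`-th term into `μ(d) d^(-σ)` times one fixed integral.
The exchange of sum and integral is justified by convergence of `∑ d^(-σ)`. -/
lemma hasSum_integral_coprimeError {σ : ℝ} (h1 : 1 < σ) (h2 : σ ≤ 3 / 2) :
    HasSum (fun d : ℕ => (μ d : ℝ) * (1 / (d : ℝ) ^ σ) * ∫ u in Ioi 0, defectKernel σ u)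
      (∫ x in Ioi 0, coprimeError 2 x * x ^ (-1 - σ)) := by
  obtain ⟨hint, -⟩ := integrableOn_defectKernel h1 h2
  set F : ℕ → ℝ → ℝ := fun d x => (μ d : ℝ) * ((d : ℝ) ^ (-1 - σ) * defectKernel σ (x * (d : ℝ)⁻¹))
    with hF
  have hpow : ∀ d : ℕ, 0 < d → (d : ℝ) ^ (-1 - σ) * d = 1 / (d : ℝ) ^ σ := fun d hd => by
    have hd' : (0 : ℝ) < d := by exact_mod_cast hd
    rw [one_div, ← Real.rpow_neg hd'.le]
    nth_rewrite 2 [← Real.rpow_one (d : ℝ)]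
    rw [← Real.rpow_add hd']
    congr 1
    ring
  have hFint : ∀ d, IntegrableOn (F d) (Ioi 0) := fun d => by
    rcases Nat.eq_zero_or_pos d with rfl | hd
    · simp [hF]
    · have hd' : (0 : ℝ) < (d : ℝ)⁻¹ := by positivity
      refine Integrable.const_mul (Integrable.const_mul ?_ _) _
      have := (integrableOn_Ioi_comp_mul_right_iff (defectKernel σ) 0 hd').2 (by simpa using hint)
      exact this
  have hval : ∀ (g : ℝ → ℝ) (d : ℕ), 0 < d →
      ∫ x in Ioi 0, g (x * (d : ℝ)⁻¹) = d * ∫ u in Ioi 0, g u := fun g d hd => by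
    rw [integral_comp_mul_right_Ioi g 0 (by positivity : (0 : ℝ) < (d : ℝ)⁻¹)]
    simp
  have hFval : ∀ d, ∫ x in Ioi 0, F d x =
      (μ d : ℝ) * (1 / (d : ℝ) ^ σ) * ∫ u in Ioi 0, defectKernel σ u := fun d => by
    rcases Nat.eq_zero_or_pos d with rfl | hd
    · simp [hF]
    · rw [hF]
      simp only
      rw [integral_const_mul, integral_const_mul, hval _ d hd, ← hpow d hd]
      ring
  have hFnorm : ∀ d, ∫ x in Ioi 0, ‖F d x‖ =
      |(μ d : ℝ)| * (1 / (d : ℝ) ^ σ) * ∫ u in Ioi 0, ‖defectKernel σ u‖ := fun d => by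
    rcases Nat.eq_zero_or_pos d with rfl | hd
    · simp [hF]
    · simp only [hF, norm_mul]
      rw [integral_const_mul, integral_const_mul, hval (fun u => ‖defectKernel σ u‖) d hd,
        ← hpow d hd, Real.norm_eq_abs, Real.norm_of_nonneg (by positivity)]
      ring
  have hsum : Summable fun d => ∫ x in Ioi 0, ‖F d x‖ := by
    simp_rw [hFnorm]
    refine Summable.mul_right _ (Summable.of_nonneg_of_le (fun d => by positivity) (fun d => ?_)
      (Real.summable_one_div_nat_rpow.2 h1))
    exact mul_le_of_le_one_left (by positivity) (abs_moebius_cast_le_one d)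
  have key := hasSum_integral_of_summable_integral_norm hFint hsum
  simp_rw [hFval] at key
  have hEF : ∫ x in Ioi 0, coprimeError 2 x * x ^ (-1 - σ) = ∫ x in Ioi 0, ∑' d, F d x := by
    refine setIntegral_congr_fun measurableSet_Ioi fun x hx => ?_
    have hx : 0 < x := hx
    rw [← (hasSum_coprimeError le_rfl x).tsum_eq, ← tsum_mul_right]
    refine tsum_congr fun d => ?_
    rcases Nat.eq_zero_or_pos d with rfl | hd
    · simp [hF]
    · rw [mul_assoc, defectKernel_mul_inv hx hd]
  rw [hEF]
  exact key

lemma eventually_le_three_halves : ∀ᶠ σ : ℝ in 𝓝[>] 1, σ ≤ 3 / 2 :=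
  (eventually_le_nhds (by norm_num : (1 : ℝ) < 3 / 2)).filter_mono nhdsWithin_le_nhds

/-- The zero of `1/ζ(σ)` at `1` cancels the growth of the kernel's integral: `2(σ-1) · 3/(σ-1) = 6`.
-/
lemma eventually_abs_integral_coprimeError_le :
    ∀ᶠ σ : ℝ in 𝓝[>] 1, |∫ x in Ioi 0, coprimeError 2 x * x ^ (-1 - σ)| ≤ 6 := by
  filter_upwards [eventually_abs_tsum_moebius_le, eventually_le_three_halves, self_mem_nhdsWithin] with σ hm h2 h1
  have h1 : 1 < σ := h1
  obtain ⟨-, hb⟩ := integrableOn_defectKernel h1 h2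
  rw [← (hasSum_integral_coprimeError h1 h2).tsum_eq, tsum_mul_right, abs_mul]
  have hpos : 0 < σ - 1 := by linarith
  calc _ ≤ 2 * (σ - 1) * (3 / (σ - 1)) := by
        gcongr
        exact (norm_integral_le_integral_norm _).trans hb
    _ = 6 := by field_simp; norm_num

lemma measurable_coprimeError (k : ℕ) : Measurable (coprimeError k) := by
  unfold coprimeError
  have : Measurable fun x : ℝ => (coprimeCount k ⌊x⌋₊ : ℝ) :=
    (measurable_from_nat (f := fun n => (coprimeCount k n : ℝ))).comp Nat.measurable_floor
  fun_prop

lemma integrableOn_coprimeError {σ : ℝ} (h1 : 1 < σ) (h2 : σ ≤ 3 / 2) :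
    IntegrableOn (fun x => coprimeError 2 x * x ^ (-1 - σ)) (Ioc 0 1) ∧
    IntegrableOn (fun x => coprimeError 2 x * x ^ (-1 - σ)) (Ioi 1) := by
  have hm : Measurable fun x => coprimeError 2 x * x ^ (-1 - σ) := by
    have := measurable_coprimeError 2
    fun_prop
  obtain ⟨C, hC, hb⟩ := abs_coprimeError_le le_rfl (s := (1 + σ) / 2)
    (by push_cast; linarith) (by push_cast; linarith)
  obtain ⟨D, hD, hb'⟩ := abs_coprimeError_le le_rfl (s := (2 : ℝ)) (by norm_num) (by norm_num)
  have hle : ∀ {A s : ℝ}, (∀ x : ℝ, 0 < x → |coprimeError 2 x| ≤ A * x ^ s) → ∀ x : ℝ, 0 < x →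
      ‖coprimeError 2 x * x ^ (-1 - σ)‖ ≤ A * x ^ (s - 1 - σ) := fun {A s} h x hx => by
    rw [norm_mul, Real.norm_eq_abs, Real.norm_of_nonneg (by positivity)]
    calc _ ≤ (A * x ^ s) * x ^ (-1 - σ) := by gcongr; exact h x hx
      _ = _ := by
        rw [mul_assoc, ← Real.rpow_add hx]
        congr 2
        ring
  constructor
  · have i1 : IntegrableOn (fun u : ℝ => D * u ^ (2 - 1 - σ)) (Ioc 0 1) := by
      rw [← intervalIntegrable_iff_integrableOn_Ioc_of_le zero_le_one]
      exact (intervalIntegral.intervalIntegrable_rpow' (by linarith)).const_mul D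
    exact Integrable.mono' i1 hm.aestronglyMeasurable
      ((ae_restrict_mem measurableSet_Ioc).mono fun u hu => hle hb' u hu.1)
  · have i2 : IntegrableOn (fun u : ℝ => C * u ^ ((1 + σ) / 2 - 1 - σ)) (Ioi 1) :=
      (integrableOn_Ioi_rpow_of_lt (by linarith) one_pos).const_mul C
    exact Integrable.mono' i2 hm.aestronglyMeasurable
      ((ae_restrict_mem measurableSet_Ioi).mono fun u hu => hle hb u (one_pos.trans hu))

lemma exists_eventually_abs_integral_coprimeError_le :
    ∃ K : ℝ, ∀ᶠ σ : ℝ in 𝓝[>] 1, |∫ x in Ioi 1, coprimeError 2 x * x ^ (-1 - σ)| ≤ K := by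
  obtain ⟨D, hD, hb'⟩ := abs_coprimeError_le le_rfl (s := (2 : ℝ)) (by norm_num) (by norm_num)
  refine ⟨6 + D * 2, ?_⟩
  filter_upwards [eventually_abs_integral_coprimeError_le, eventually_le_three_halves, self_mem_nhdsWithin] with σ hI h2 h1
  have h1 : 1 < σ := h1
  obtain ⟨j1, j2⟩ := integrableOn_coprimeError h1 h2
  rw [← Ioc_union_Ioi_eq_Ioi zero_le_one,
    setIntegral_union Ioc_disjoint_Ioi_same measurableSet_Ioi j1 j2] at hI
  have i1 : IntegrableOn (fun u : ℝ => D * u ^ (1 - σ)) (Ioc 0 1) := by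
    rw [← intervalIntegrable_iff_integrableOn_Ioc_of_le zero_le_one]
    exact (intervalIntegral.intervalIntegrable_rpow' (by linarith)).const_mul D
  have e1 : |∫ x in Ioc 0 1, coprimeError 2 x * x ^ (-1 - σ)| ≤ D * 2 := by
    rw [← Real.norm_eq_abs]
    refine (norm_integral_le_of_norm_le i1
      ((ae_restrict_mem measurableSet_Ioc).mono fun x hx => ?_)).trans ?_
    · rw [norm_mul, Real.norm_eq_abs, Real.norm_of_nonneg (Real.rpow_nonneg hx.1.le _)]
      calc _ ≤ (D * x ^ (2 : ℝ)) * x ^ (-1 - σ) :=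
            mul_le_mul_of_nonneg_right (hb' x hx.1) (Real.rpow_nonneg hx.1.le _)
        _ = _ := by
          rw [mul_assoc, ← Real.rpow_add hx.1]
          congr 2
          ring
    · rw [integral_const_mul, ← intervalIntegral.integral_of_le zero_le_one,
        integral_rpow (Or.inl (by linarith)), Real.one_rpow, Real.zero_rpow (by linarith)]
      gcongr
      rw [sub_zero, div_le_iff₀ (by linarith)]
      linarith
  rw [abs_le] at *
  constructor <;> linarith [hI.1, hI.2, e1.1, e1.2]

end LatticeVisibility

end

/-! ### From the integral to a sum over integers -/

noncomputable section

namespace LatticeVisibility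

open MeasureTheory Set

lemma coprimeError_eq_on_Ico {L : ℕ} {x : ℝ} (h1 : (L : ℝ) ≤ x) (h2 : x < L + 1) :
    coprimeError 2 x = coprimeError 2 L - (x ^ 2 - (L : ℝ) ^ 2) / zeta 2 := by
  have h0 : (0 : ℝ) ≤ L := by positivity
  rw [coprimeError, coprimeError, Nat.floor_natCast,
    (Nat.floor_eq_iff (h0.trans h1)).2 ⟨h1, h2⟩]
  ring

/-- Bernoulli's inequality applied to `(a/x)^p`. -/
lemma rpow_neg_sub_rpow_neg_le {p a x : ℝ} (hp : 1 ≤ p) (ha : 1 ≤ a) (h1 : a ≤ x)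
    (h2 : x ≤ a + 1) : |x ^ (-p) - a ^ (-p)| ≤ a ^ (-p) * (p / a) := by
  have ha0 : 0 < a := by linarith
  have hx0 : 0 < x := by linarith
  have hle : x ^ (-p) ≤ a ^ (-p) := Real.rpow_le_rpow_of_nonpos ha0 h1 (by linarith)
  rw [abs_of_nonpos (by linarith)]
  have hq : x ^ (-p) = a ^ (-p) * (a / x) ^ p := by
    rw [Real.div_rpow ha0.le hx0.le, Real.rpow_neg ha0.le, Real.rpow_neg hx0.le]
    field_simp
  have hs : -1 ≤ a / x - 1 := by linarith [div_nonneg ha0.le hx0.le]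
  have hb := one_add_mul_self_le_rpow_one_add hs hp
  rw [add_sub_cancel] at hb
  have h3 : 1 - a / x ≤ 1 / a := by
    rw [sub_le_iff_le_add, div_add_div _ _ ha0.ne' hx0.ne', le_div_iff₀ (by positivity)]
    nlinarith
  have h4 : p * (1 - a / x) ≤ p * (1 / a) := mul_le_mul_of_nonneg_left h3 (by linarith)
  have h5 : 1 - (a / x) ^ p ≤ p / a := by
    rw [mul_one_div] at h4; linarith
  rw [hq]
  have h6 : 0 < a ^ (-p) := by positivity
  nlinarith

/-- On `[L, L+1)` the error falls from `E(L)` by `(x² - L²)/ζ(2)`, whose linear part `2L(x-L)/ζ(2)`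
has average `L/ζ(2)`. Freezing the weight at `L` and dropping the quadratic part cost `O(L^(-3/2))`,
summable and uniform in `σ`. -/
lemma exists_abs_integral_sub_le :
    ∃ C : ℝ, 0 ≤ C ∧ ∀ σ : ℝ, 1 < σ → σ ≤ 3 / 2 → ∀ L : ℕ, 1 ≤ L →
      |(∫ x in (L : ℝ)..(L + 1 : ℝ), coprimeError 2 x * x ^ (-1 - σ)) -
        (L : ℝ) ^ (-1 - σ) * (coprimeError 2 L - L / zeta 2)| ≤ C * (1 / (L : ℝ) ^ (3 / 2 : ℝ)) := by
  obtain ⟨D, hD, hE⟩ := abs_coprimeError_le le_rfl (s := (3 / 2 : ℝ)) (by norm_num) (by norm_num)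
  have hz : 0 < 1 / zeta 2 := one_div_pos.2 (one_pos.trans (one_lt_zeta le_rfl))
  set κ := 1 / zeta 2 with hκ
  refine ⟨3 * D + 10 * κ, by positivity, fun σ h1 h2 L hL => ?_⟩
  have hL1 : (1 : ℝ) ≤ L := by exact_mod_cast hL
  have hL0 : (0 : ℝ) < L := by linarith
  have hEL := hE L hL0
  set e := coprimeError 2 L with he
  set q := (L : ℝ) ^ (-1 - σ) with hq
  have hq0 : 0 < q := by positivity
  have hlin : ∫ x in (L : ℝ)..(L + 1 : ℝ), q * (e - 2 * κ * L * (x - L)) = q * (e - L / zeta 2) := by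
    rw [intervalIntegral.integral_const_mul, intervalIntegral.integral_sub (by simp)
      (Continuous.intervalIntegrable (by fun_prop) _ _), intervalIntegral.integral_const_mul,
      intervalIntegral.integral_sub (Continuous.intervalIntegrable (by fun_prop) _ _) (by simp),
      integral_id]
    simp only [intervalIntegral.integral_const, smul_eq_mul]
    rw [hκ]
    ring
  have hint1 : IntervalIntegrable (fun x => coprimeError 2 x * x ^ (-1 - σ)) volume
      (L : ℝ) (L + 1 : ℝ) := by
    rw [intervalIntegrable_iff_integrableOn_Ioc_of_le (by linarith)]
    exact (integrableOn_coprimeError h1 h2).2.mono_set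
      fun x hx => lt_of_le_of_lt hL1 hx.1
  rw [← hlin, ← intervalIntegral.integral_sub hint1
    (Continuous.intervalIntegrable (by fun_prop) _ _), ← Real.norm_eq_abs]
  have hbound : ∀ x : ℝ, (L : ℝ) ≤ x → x < L + 1 →
      ‖coprimeError 2 x * x ^ (-1 - σ) - q * (e - 2 * κ * L * (x - L))‖ ≤
        (3 * D + 10 * κ) * (1 / (L : ℝ) ^ (3 / 2 : ℝ)) := by
    intro x hx1 hx2
    have hr := rpow_neg_sub_rpow_neg_le (p := 1 + σ) (by linarith) hL1 hx1 hx2.le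
    rw [show -(1 + σ) = -1 - σ by ring] at hr
    rw [coprimeError_eq_on_Ico hx1 hx2, Real.norm_eq_abs]
    have e1 : (e - (x ^ 2 - (L : ℝ) ^ 2) / zeta 2) * x ^ (-1 - σ) - q * (e - 2 * κ * L * (x - L)) =
        (e - κ * ((x - L) * (x + L))) * (x ^ (-1 - σ) - q) - q * (κ * (x - L) ^ 2) := by
      rw [hκ]; ring
    rw [e1]
    have ht0 : 0 ≤ x - L := by linarith
    have ht1 : x - L ≤ 1 := by linarith
    have hLp : (L : ℝ) ≤ (L : ℝ) ^ (3 / 2 : ℝ) := by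
      nth_rewrite 1 [← Real.rpow_one (L : ℝ)]
      exact Real.rpow_le_rpow_of_exponent_le hL1 (by norm_num)
    set P := (L : ℝ) ^ (3 / 2 : ℝ) with hP
    have hP0 : 0 < P := by positivity
    have e2 : |e - κ * ((x - L) * (x + L))| ≤ (D + 3 * κ) * P := by
      have h3 : (x - L) * (x + L) ≤ 3 * P := by nlinarith
      have h4 : 0 ≤ κ * ((x - L) * (x + L)) :=
        mul_nonneg hz.le (mul_nonneg ht0 (by linarith))
      have h5 := abs_le.1 hEL
      have h6 : κ * ((x - L) * (x + L)) ≤ κ * (3 * P) := by gcongr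
      rw [abs_le]
      constructor <;> nlinarith [h5.1, h5.2, mul_pos hz hP0]
    have e3 : |x ^ (-1 - σ) - q| ≤ 3 * (q / L) := by
      refine hr.trans ?_
      rw [← hq, ← mul_div_assoc, ← mul_div_assoc]
      gcongr ?_ / _
      nlinarith
    have e4 : q ≤ 1 / (L : ℝ) ^ (2 : ℝ) := by
      rw [one_div, ← Real.rpow_neg hL0.le]
      exact Real.rpow_le_rpow_of_exponent_le hL1 (by linarith)
    have e5 : |q * (κ * (x - L) ^ 2)| ≤ q * κ := by
      rw [abs_of_nonneg (by positivity)]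
      gcongr
      exact mul_le_of_le_one_right hz.le (by nlinarith)
    have e6 : q ≤ q / L * P := by
      rw [div_mul_eq_mul_div, le_div_iff₀ hL0]
      gcongr
    have e7 : q / L * P ≤ 1 / P := by
      have : P * P = L * (L : ℝ) ^ (2 : ℝ) := by
        rw [hP, ← Real.rpow_add hL0]
        nth_rewrite 2 [← Real.rpow_one (L : ℝ)]
        rw [← Real.rpow_add hL0]
        norm_num
      rw [le_div_iff₀ hP0, mul_assoc, this, div_mul_eq_mul_div, ← mul_assoc, mul_comm q,
        div_le_one hL0, mul_assoc]
      rw [le_div_iff₀ (by positivity)] at e4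
      nlinarith
    calc _ ≤ |(e - κ * ((x - L) * (x + L))) * (x ^ (-1 - σ) - q)| + |q * (κ * (x - L) ^ 2)| :=
          abs_sub _ _
      _ ≤ (D + 3 * κ) * P * (3 * (q / L)) + q * κ := by
          rw [abs_mul]
          gcongr
      _ ≤ (D + 3 * κ) * P * (3 * (q / L)) + (q / L * P) * κ := by gcongr
      _ = (3 * D + 10 * κ) * (q / L * P) := by ring
      _ ≤ _ := by gcongr
  refine (intervalIntegral.norm_integral_le_of_norm_le_const_ae
    (C := (3 * D + 10 * κ) * (1 / (L : ℝ) ^ (3 / 2 : ℝ))) ?_).trans (le_of_eq ?_)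
  rotate_left
  · rw [add_sub_cancel_left, abs_one, mul_one]
  -- The floor jumps at the right endpoint, so the bound holds only off this null set.
  have hne : ∀ᵐ x : ℝ, x ≠ (L : ℝ) + 1 := by simp [ae_iff]
  filter_upwards [hne] with x hx hmem
  rw [uIoc_of_le (by linarith)] at hmem
  exact hbound x hmem.1.le (lt_of_le_of_ne hmem.2 hx)

lemma exists_eventually_abs_sum_coprimeError_le :
    ∃ K : ℝ, ∀ᶠ σ : ℝ in 𝓝[>] 1, ∀ᶠ n : ℕ in atTop,
      |∑ i ∈ Finset.range n, ((i + 1 : ℕ) : ℝ) ^ (-1 - σ) *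
        (coprimeError 2 (i + 1 : ℕ) - ((i + 1 : ℕ) : ℝ) / zeta 2)| ≤ K := by
  obtain ⟨K, hK⟩ := exists_eventually_abs_integral_coprimeError_le
  obtain ⟨C, hC, hCb⟩ := exists_abs_integral_sub_le
  have hs : Summable fun i : ℕ => 1 / ((i + 1 : ℕ) : ℝ) ^ (3 / 2 : ℝ) :=
    (summable_nat_add_iff (f := fun i : ℕ => 1 / (i : ℝ) ^ (3 / 2 : ℝ)) 1).2
      (Real.summable_one_div_nat_rpow.2 (by norm_num))
  refine ⟨K + 1 + C * ∑' i : ℕ, 1 / ((i + 1 : ℕ) : ℝ) ^ (3 / 2 : ℝ), ?_⟩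
  filter_upwards [hK, eventually_le_three_halves, self_mem_nhdsWithin] with σ hI h2 h1
  have h1 : 1 < σ := h1
  have hint := (integrableOn_coprimeError h1 h2).2
  have hlim : Tendsto (fun n : ℕ => (n : ℝ) + 1) atTop atTop :=
    tendsto_atTop_add_const_right _ _ tendsto_natCast_atTop_atTop
  have ht := (intervalIntegral_tendsto_integral_Ioi 1 hint hlim).abs
  filter_upwards [ht.eventually (gt_mem_nhds (by linarith : _ < K + 1))] with n hn
  have hadj : ∑ i ∈ Finset.range n, ∫ x in ((i + 1 : ℕ) : ℝ)..(((i + 1 : ℕ) : ℝ) + 1),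
      coprimeError 2 x * x ^ (-1 - σ) = ∫ x in (1 : ℝ)..((n : ℝ) + 1),
      coprimeError 2 x * x ^ (-1 - σ) := by
    have := intervalIntegral.sum_integral_adjacent_intervals (μ := volume)
      (f := fun x => coprimeError 2 x * x ^ (-1 - σ)) (a := fun i : ℕ => (i : ℝ) + 1) (n := n)
      fun i _ => by
        rw [intervalIntegrable_iff_integrableOn_Ioc_of_le (by push_cast; linarith)]
        refine hint.mono_set fun x hx => lt_of_le_of_lt ?_ hx.1
        linarith [(Nat.cast_nonneg i : (0 : ℝ) ≤ i)]
    simpa using this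
  rw [← hadj] at hn
  set A := ∑ i ∈ Finset.range n, ∫ x in ((i + 1 : ℕ) : ℝ)..(((i + 1 : ℕ) : ℝ) + 1),
      coprimeError 2 x * x ^ (-1 - σ)
  set B := ∑ i ∈ Finset.range n, ((i + 1 : ℕ) : ℝ) ^ (-1 - σ) *
        (coprimeError 2 (i + 1 : ℕ) - ((i + 1 : ℕ) : ℝ) / zeta 2)
  have hAB : |A - B| ≤ C * ∑' i : ℕ, 1 / ((i + 1 : ℕ) : ℝ) ^ (3 / 2 : ℝ) := by
    rw [← Finset.sum_sub_distrib]
    refine (Finset.abs_sum_le_sum_abs _ _).trans ?_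
    refine (Finset.sum_le_sum fun i _ => hCb σ h1 h2 (i + 1) (by omega)).trans ?_
    rw [← Finset.mul_sum]
    gcongr
    exact hs.sum_le_tsum _ fun i _ => by positivity
  calc |B| = |A - (A - B)| := by congr 1; ring
    _ ≤ |A| + |A - B| := abs_sub _ _
    _ ≤ _ := by linarith

end LatticeVisibility

end

/-! ### No periodic minorant of positive mean; `Ω_+` and totient increments for `k = 2` -/

noncomputable section

namespace LatticeVisibility

open scoped ArithmeticFunction.Moebius

lemma summable_periodic_mul_rpow {p : ℕ → ℝ} {M : ℕ} (hM : 0 < M) (hp : Function.Periodic p M)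
    {σ : ℝ} (hσ : 1 < σ) : Summable fun n : ℕ => p n * (n : ℝ) ^ (-σ) := by
  have hb : ∀ n, |p n| ≤ ∑ l ∈ Finset.range M, |p l| := fun n => by
    rw [← hp.map_mod_nat n]
    exact Finset.single_le_sum (f := fun l => |p l|) (fun _ _ => abs_nonneg _)
      (Finset.mem_range.2 (Nat.mod_lt _ hM))
  refine Summable.of_norm_bounded
    ((Real.summable_nat_rpow.2 (by linarith : -σ < -1)).mul_left (∑ l ∈ Finset.range M, |p l|))
    fun n => ?_
  rw [norm_mul, Real.norm_eq_abs, Real.norm_of_nonneg (by positivity)]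
  gcongr
  exact hb n

/-- A periodic function defines an `L`-function on `ZMod M` whose residue at `1` is its mean. -/
lemma tendsto_sub_one_mul_tsum_periodic {p : ℕ → ℝ} {M : ℕ} (hM : 0 < M)
    (hp : Function.Periodic p M) :
    Tendsto (fun σ : ℝ => (σ - 1) * ∑' n : ℕ, p n * (n : ℝ) ^ (-σ)) (𝓝[>] 1)
      (𝓝 ((∑ l ∈ Finset.range M, p l) / M)) := by
  have : NeZero M := ⟨hM.ne'⟩
  set Φ : ZMod M → ℂ := fun j => (p j.val : ℂ) with hΦ
  have hmean : ∑ j, Φ j / M = (((∑ l ∈ Finset.range M, p l) / M : ℝ) : ℂ) := by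
    rw [← Finset.sum_div]
    push_cast
    congr 1
    obtain ⟨m, rfl⟩ := Nat.exists_eq_succ_of_ne_zero hM.ne'
    exact Fin.sum_univ_eq_sum_range (fun l => (p l : ℂ)) (m + 1)
  have hcast : Tendsto (fun σ : ℝ => (σ : ℂ)) (𝓝[>] 1) (𝓝[≠] 1) := by
    refine tendsto_nhdsWithin_iff.2 ⟨?_, ?_⟩
    · exact (Complex.continuous_ofReal.tendsto' 1 1 (by simp)).mono_left nhdsWithin_le_nhds
    · filter_upwards [self_mem_nhdsWithin] with σ hσ
      have hσ : 1 < σ := hσ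
      simp only [Set.mem_compl_iff, Set.mem_singleton_iff]
      exact_mod_cast hσ.ne'
  have h := (ZMod.LFunction_residue_one Φ).comp hcast
  rw [hmean] at h
  rw [← Filter.tendsto_ofReal_iff]
  refine h.congr' ?_
  filter_upwards [self_mem_nhdsWithin] with σ hσ
  have hσ : 1 < σ := hσ
  simp only [Function.comp_apply]
  rw [ZMod.LFunction_eq_LSeries Φ (by simpa using hσ), LSeries]
  push_cast
  congr 1
  refine tsum_congr fun n => ?_
  rcases eq_or_ne n 0 with rfl | hn
  · simp [Real.zero_rpow (by linarith : -σ ≠ 0)]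
  · rw [LSeries.term_of_ne_zero hn, hΦ]
    simp only
    rw [ZMod.val_natCast, hp.map_mod_nat, Real.rpow_neg (by positivity)]
    push_cast
    rw [Complex.ofReal_cpow (by positivity)]
    push_cast
    rw [div_eq_mul_inv]

lemma tendsto_tsum_periodic_atTop {p : ℕ → ℝ} {M : ℕ} (hM : 0 < M) (hp : Function.Periodic p M)
    (hpos : 0 < ∑ l ∈ Finset.range M, p l) :
    Tendsto (fun σ : ℝ => ∑' n : ℕ, p n * (n : ℝ) ^ (-σ)) (𝓝[>] 1) atTop := by
  have h1 : Tendsto (fun σ : ℝ => (σ - 1)⁻¹) (𝓝[>] 1) atTop := by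
    refine tendsto_inv_nhdsGT_zero.comp (tendsto_nhdsWithin_iff.2 ⟨?_, ?_⟩)
    · exact ((continuous_sub_right (1 : ℝ)).tendsto' 1 0 (by simp)).mono_left nhdsWithin_le_nhds
    · filter_upwards [self_mem_nhdsWithin] with σ hσ
      exact sub_pos.2 (Set.mem_Ioi.1 hσ)
  have h2 := h1.atTop_mul_pos (by positivity) (tendsto_sub_one_mul_tsum_periodic hM hp)
  refine h2.congr' ?_
  filter_upwards [self_mem_nhdsWithin] with σ hσ
  have hσ : σ - 1 ≠ 0 := (sub_pos.2 (Set.mem_Ioi.1 hσ)).ne'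
  field_simp

/-- Multiply the inequality by `L^(-1-σ)` and sum. The right side stays bounded as `σ → 1+` and the
`C` term is at most `C ∑ L^(-2)`, while `∑ p(L) L^(-σ)` diverges to `+∞`. The factor `s` allows both
signs of the error to be treated at once. -/
lemma not_periodic_le_coprimeError {p : ℕ → ℝ} {M : ℕ} (hM : 0 < M) (hp : Function.Periodic p M)
    (hpos : 0 < ∑ l ∈ Finset.range M, p l) {s C : ℝ} (hs : |s| ≤ 1) (hC : 0 ≤ C)
    (h : ∀ L : ℕ, 1 ≤ L → p L * L - C ≤ s * (coprimeError 2 L - L / zeta 2)) : False := by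
  obtain ⟨K, hK⟩ := exists_eventually_abs_sum_coprimeError_le
  have hsum : Summable fun i : ℕ => 1 / ((i + 1 : ℕ) : ℝ) ^ 2 :=
    (summable_nat_add_iff (f := fun i : ℕ => 1 / (i : ℝ) ^ 2) 1).2
      (Real.summable_one_div_nat_pow.2 one_lt_two)
  set Z := ∑' i : ℕ, 1 / ((i + 1 : ℕ) : ℝ) ^ 2
  obtain ⟨σ, hσK, hσp, hσ1⟩ := (hK.and (((tendsto_tsum_periodic_atTop hM hp hpos).eventually
    (eventually_gt_atTop (K + C * Z))).and self_mem_nhdsWithin)).exists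
  have hσ1 : 1 < σ := hσ1
  have hsummable := summable_periodic_mul_rpow hM hp hσ1
  have hlim := hsummable.hasSum.tendsto_sum_nat.comp (tendsto_add_atTop_nat 1)
  refine absurd (le_of_tendsto hlim ?_) (not_le.2 hσp)
  filter_upwards [hσK] with n hn
  simp only [Function.comp_apply]
  rw [Finset.sum_range_succ']
  simp only [Nat.cast_zero, Real.zero_rpow (by linarith : -σ ≠ 0), mul_zero, add_zero]
  have h1 : ∀ i : ℕ, p (i + 1) * ((i + 1 : ℕ) : ℝ) ^ (-σ) ≤
      s * (((i + 1 : ℕ) : ℝ) ^ (-1 - σ) *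
        (coprimeError 2 (i + 1 : ℕ) - ((i + 1 : ℕ) : ℝ) / zeta 2)) +
      C * (1 / ((i + 1 : ℕ) : ℝ) ^ 2) := fun i => by
    have hL0 : (0 : ℝ) < ((i + 1 : ℕ) : ℝ) := by positivity
    have hL1 : (1 : ℝ) ≤ ((i + 1 : ℕ) : ℝ) := by exact_mod_cast Nat.le_add_left 1 i
    have hi := h (i + 1) (by omega)
    set L : ℝ := ((i + 1 : ℕ) : ℝ)
    have e1 : L ^ (-σ) = L ^ (-1 - σ) * L := by
      nth_rewrite 3 [← Real.rpow_one L]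
      rw [← Real.rpow_add hL0]
      congr 1
      ring
    have e2 : L ^ (-1 - σ) ≤ 1 / L ^ 2 := by
      rw [one_div, ← Real.rpow_natCast, ← Real.rpow_neg hL0.le]
      exact Real.rpow_le_rpow_of_exponent_le hL1 (by push_cast; linarith)
    have e3 : 0 < L ^ (-1 - σ) := by positivity
    rw [e1]
    nlinarith [mul_le_mul_of_nonneg_left hi e3.le, mul_le_mul_of_nonneg_left e2 hC]
  refine (Finset.sum_le_sum fun i _ => h1 i).trans ?_
  rw [Finset.sum_add_distrib, ← Finset.mul_sum, ← Finset.mul_sum]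
  refine add_le_add ?_ (mul_le_mul_of_nonneg_left (hsum.sum_le_tsum _ fun i _ => by positivity) hC)
  refine (le_abs_self _).trans ?_
  rw [abs_mul]
  calc _ ≤ 1 * _ := mul_le_mul_of_nonneg_right hs (abs_nonneg _)
    _ ≤ K := by rw [one_mul]; exact hn

lemma not_periodic_le_coprimeError_of_eventually {p : ℕ → ℝ} {M : ℕ} (hM : 0 < M)
    (hp : Function.Periodic p M) (hpos : 0 < ∑ l ∈ Finset.range M, p l) {s C : ℝ} (hs : |s| ≤ 1)
    (h : ∀ᶠ L : ℕ in atTop, p L * L - C ≤ s * (coprimeError 2 L - L / zeta 2)) : False := by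
  obtain ⟨N, hN⟩ := eventually_atTop.1 h
  -- The finitely many exceptional `L` are absorbed into the constant.
  set D := ∑ l ∈ Finset.range N, |p l * l - s * (coprimeError 2 l - l / zeta 2)| with hD
  have hD0 : 0 ≤ D := Finset.sum_nonneg fun _ _ => abs_nonneg _
  refine not_periodic_le_coprimeError hM hp hpos hs (C := |C| + D) (by positivity) fun L _ => ?_
  rcases lt_or_ge L N with hL | hL
  · have := Finset.single_le_sum
      (f := fun l : ℕ => |p l * l - s * (coprimeError 2 l - l / zeta 2)|)
      (fun _ _ => abs_nonneg _) (Finset.mem_range.2 hL)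
    have h1 := le_abs_self (p L * L - s * (coprimeError 2 L - L / zeta 2))
    have h2 := abs_nonneg C
    linarith
  · have := hN L hL
    have := le_abs_self C
    linarith

/-- If `E(L) < κL/2` eventually, then `κL - E(L) > κL/2`, a forbidden minorant with constant
coefficient. -/
lemma isOmegaPlus_two :
    IsOmegaPlus (fun L : ℕ => (count (visibleFromOrigin 2) L : ℝ) - (L : ℝ) ^ 2 / zeta 2)
      (fun L : ℕ => (L : ℝ) ^ (2 - 1)) := by
  by_contra hcon
  have hz : 0 < 1 / zeta 2 := one_div_pos.2 (one_pos.trans (one_lt_zeta le_rfl))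
  set κ := 1 / zeta 2 with hκ
  refine not_periodic_le_coprimeError_of_eventually (p := fun _ => κ / 2) one_pos (fun _ => rfl)
    (by simpa using hz) (s := -1) (C := 0) (by simp) ?_
  have hev := not_frequently.1 fun hf => hcon ⟨κ / 2, by positivity, hf⟩
  filter_upwards [hev] with L hL
  have hE := coprimeError_natCast two_ne_zero L
  simp only [Nat.add_one_sub_one, pow_one, not_le] at hL
  rw [← hE] at hL
  rw [← mul_one_div (L : ℝ), ← hκ]
  linarith

/-- The new points are those with largest coordinate `n + 1`. In the Möbius sum, `⌊(n+1)/d⌋` exceeds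
`⌊n/d⌋` by one exactly when `d ∣ n + 1`; the leftover `∑ μ(d)` vanishes because `n + 1 > 1`. -/
lemma coprimeCount_two_succ {n : ℕ} (hn : 1 ≤ n) :
    coprimeCount 2 (n + 1) - coprimeCount 2 n = 2 * (Nat.totient (n + 1) : ℤ) := by
  have h1 : coprimeCount 2 n = ∑ d ∈ Finset.Icc 1 (n + 1), μ d * ((n / d : ℕ) : ℤ) ^ 2 := by
    rw [Finset.sum_Icc_succ_top (by omega), Nat.div_eq_of_lt (Nat.lt_succ_self n)]
    simp [coprimeCount]
  have h2 : ∑ d ∈ (n + 1).divisors, μ d * (((n + 1) / d : ℕ) : ℤ) = Nat.totient (n + 1) := by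
    have h := (ArithmeticFunction.sum_eq_iff_sum_mul_moebius_eq (R := ℤ)
      (f := fun m => (Nat.totient m : ℤ)) (g := fun m => (m : ℤ))).1
      (fun m _ => by exact_mod_cast Nat.sum_totient m) (n + 1) (by omega)
    simp only [Int.cast_id] at h
    rwa [Nat.sum_divisorsAntidiagonal (fun a b => μ a * (b : ℤ))] at h
  have h3 : ∑ d ∈ (n + 1).divisors, μ d = 0 := by
    rw [← ArithmeticFunction.coe_mul_zeta_apply, ArithmeticFunction.moebius_mul_coe_zeta,
      ArithmeticFunction.one_apply_ne (by omega)]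
  rw [h1, coprimeCount, ← Finset.sum_sub_distrib]
  have h4 : ∀ d ∈ Finset.Icc 1 (n + 1), μ d * (((n + 1) / d : ℕ) : ℤ) ^ 2 -
      μ d * ((n / d : ℕ) : ℤ) ^ 2 =
      if d ∣ n + 1 then 2 * (μ d * (((n + 1) / d : ℕ) : ℤ)) - μ d else 0 := fun d _ => by
    rw [Nat.succ_div]
    split_ifs
    · push_cast; ring
    · simp
  rw [Finset.sum_congr rfl h4, ← Finset.sum_filter]
  have h5 : (Finset.Icc 1 (n + 1)).filter (· ∣ n + 1) = (n + 1).divisors := rfl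
  rw [h5, Finset.sum_sub_distrib, ← Finset.mul_sum, h2, h3, sub_zero]

lemma coprimeError_two_add {L : ℕ} (hL : 1 ≤ L) (j : ℕ) :
    coprimeError 2 (L + j : ℕ) = coprimeError 2 L + ∑ i ∈ Finset.range j,
      (2 * (Nat.totient (L + i + 1) : ℝ) - (2 * ((L + i : ℕ) : ℝ) + 1) / zeta 2) := by
  induction j with
  | zero => simp
  | succ j ih =>
    rw [Finset.sum_range_succ, ← add_assoc (coprimeError 2 L), ← ih, ← add_assoc L]
    have h := coprimeCount_two_succ (by omega : 1 ≤ L + j)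
    have h' : (coprimeCount 2 (L + j + 1) : ℝ) - coprimeCount 2 (L + j) =
        2 * (Nat.totient (L + j + 1) : ℝ) := by exact_mod_cast h
    have e : (coprimeCount 2 (L + j + 1) : ℝ) = coprimeCount 2 (L + j) +
        2 * (Nat.totient (L + j + 1) : ℝ) := by linarith
    rw [coprimeError, coprimeError, Nat.floor_natCast, Nat.floor_natCast, e]
    push_cast
    ring

end LatticeVisibility

end

/-! ### Averages of truncated totient products and sawtooth sums -/

noncomputable section

namespace LatticeVisibility

/-- The part of `φ(l) / l` coming from the primes in `S`. -/
def sieveFactor (S : Finset ℕ) (l : ℕ) : ℝ := ∏ p ∈ S, (1 - if p ∣ l then 1 / (p : ℝ) else 0)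

lemma sieveFactor_term_mem (p l : ℕ) :
    (1 - if p ∣ l then 1 / (p : ℝ) else 0) ∈ Set.Icc (0 : ℝ) 1 := by
  split_ifs
  · have := Nat.cast_inv_le_one (α := ℝ) p
    have h : (0 : ℝ) ≤ (p : ℝ)⁻¹ := by positivity
    rw [one_div]
    constructor <;> linarith
  · simp

lemma sieveFactor_le_one (S : Finset ℕ) (l : ℕ) : sieveFactor S l ≤ 1 :=
  Finset.prod_le_one (fun p _ => (sieveFactor_term_mem p l).1) fun p _ =>
    (sieveFactor_term_mem p l).2

lemma sieveFactor_periodic {S : Finset ℕ} {M : ℕ} (h : ∀ p ∈ S, p ∣ M) :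
    Function.Periodic (sieveFactor S) M := fun l => by
  refine Finset.prod_congr rfl fun p hp => ?_
  simp only [Nat.dvd_add_left (h p hp)]

lemma totient_le_mul_sieveFactor {S : Finset ℕ} (hS : ∀ p ∈ S, p.Prime) {l : ℕ} (hl : l ≠ 0) :
    (Nat.totient l : ℝ) ≤ l * sieveFactor S l := by
  have h : (Nat.totient l : ℝ) = l * ∏ p ∈ l.primeFactors, (1 - 1 / (p : ℝ)) := by
    have := Nat.totient_eq_mul_prod_factors l
    have h2 : ((Nat.totient l : ℚ) : ℝ) =
        (((l : ℚ) * ∏ p ∈ l.primeFactors, (1 - (p : ℚ)⁻¹) : ℚ) : ℝ) := by rw [this]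
    push_cast at h2
    simpa using h2
  rw [h]
  gcongr
  have e1 : sieveFactor S l = ∏ p ∈ S.filter (· ∣ l), (1 - 1 / (p : ℝ)) := by
    rw [sieveFactor, Finset.prod_filter]
    refine Finset.prod_congr rfl fun p _ => ?_
    split_ifs <;> simp
  rw [e1]
  have hmem : ∀ p : ℕ, 1 - 1 / (p : ℝ) ∈ Set.Icc (0 : ℝ) 1 := fun p => by
    simpa using sieveFactor_term_mem p 0
  have hsub : S.filter (· ∣ l) ⊆ l.primeFactors := fun p hp => by
    rw [Finset.mem_filter] at hp
    exact Nat.mem_primeFactors.2 ⟨hS p hp.1, hp.2, hl⟩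
  rw [← Finset.prod_sdiff hsub]
  exact mul_le_of_le_one_left (Finset.prod_nonneg fun p _ => (hmem p).1)
    (Finset.prod_le_one (fun p _ => (hmem p).1) fun p _ => (hmem p).2)

lemma sum_range_periodic_shift {F : ℕ → ℝ} {M : ℕ} (hF : Function.Periodic F M) (c : ℕ) :
    ∑ l ∈ Finset.range M, F (l + c) = ∑ l ∈ Finset.range M, F l := by
  induction c with
  | zero => rfl
  | succ c ih =>
    rw [← ih]
    have h1 := Finset.sum_range_succ (fun l => F (l + c)) M
    have h2 := Finset.sum_range_succ' (fun l => F (l + c)) M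
    have h3 : F (M + c) = F (0 + c) := by rw [add_comm, hF, zero_add]
    have h4 : ∑ l ∈ Finset.range M, F (l + (c + 1)) = ∑ l ∈ Finset.range M, F (l + 1 + c) :=
      Finset.sum_congr rfl fun l _ => by congr 1; omega
    linarith

lemma sum_range_mul_periodic {F : ℕ → ℝ} {M : ℕ} (hF : Function.Periodic F M) (t : ℕ) :
    ∑ l ∈ Finset.range (M * t), F l = t * ∑ l ∈ Finset.range M, F l := by
  induction t with
  | zero => simp
  | succ t ih =>
    rw [Nat.mul_succ, Finset.sum_range_add, ih]
    have : ∀ x, F (M * t + x) = F x := fun x => by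
      rw [add_comm, mul_comm]
      exact hF.nat_mul t x
    simp only [this]
    push_cast
    ring

lemma sum_range_dvd {F : ℕ → ℝ} {g h : ℕ} (hg : 0 < g) :
    ∑ l ∈ Finset.range (g * h), (if g ∣ l then F l else 0) = ∑ t ∈ Finset.range h, F (g * t) := by
  rw [← Finset.sum_filter]
  symm
  refine Finset.sum_bij (fun t _ => g * t) ?_ ?_ ?_ fun _ _ => rfl
  · intro t ht
    rw [Finset.mem_filter, Finset.mem_range]
    exact ⟨Nat.mul_lt_mul_of_pos_left (Finset.mem_range.1 ht) hg, dvd_mul_right _ _⟩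
  · intro a _ b _ hab
    exact Nat.eq_of_mul_eq_mul_left hg hab
  · intro l hl
    rw [Finset.mem_filter, Finset.mem_range] at hl
    obtain ⟨hl, t, rfl⟩ := hl
    exact ⟨t, Finset.mem_range.2 (Nat.lt_of_mul_lt_mul_left hl), rfl⟩

lemma sum_range_mul_coprime {F : ℕ → ℝ} {M p : ℕ} (hF : Function.Periodic F M)
    (hp : Nat.Coprime M p) : ∑ t ∈ Finset.range M, F (p * t) = ∑ t ∈ Finset.range M, F t := by
  rcases Nat.eq_zero_or_pos M with rfl | hM
  · simp
  have hinj : Set.InjOn (fun t => p * t % M) (Finset.range M : Finset ℕ) := fun a ha b hb hab => by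
    have h1 : a ≡ b [MOD M] := Nat.ModEq.cancel_left_of_coprime hp hab
    rw [Finset.mem_coe, Finset.mem_range] at ha hb
    exact h1.eq_of_lt_of_lt ha hb
  have himg : (Finset.range M).image (fun t => p * t % M) = Finset.range M := by
    refine Finset.eq_of_subset_of_card_le (fun x hx => ?_) ?_
    · obtain ⟨t, _, rfl⟩ := Finset.mem_image.1 hx
      exact Finset.mem_range.2 (Nat.mod_lt _ hM)
    · rw [Finset.card_image_of_injOn hinj]
  conv_rhs => rw [← himg, Finset.sum_image hinj]
  exact Finset.sum_congr rfl fun t _ => (hF.map_mod_nat _).symm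

/-- The multiples of `p` contribute `∑ F(p t)`, which is a full period sum because `p` permutes the
residues modulo `M`. Each new prime thus scales the mean by `1 - 1/p²`. -/
lemma sum_range_mul_one_sub {F : ℕ → ℝ} {M p : ℕ} (hF : Function.Periodic F M)
    (hp : Nat.Coprime M p) (hp0 : 0 < p) :
    ∑ l ∈ Finset.range (M * p), F l * (1 - if p ∣ l then 1 / (p : ℝ) else 0) =
      p * (1 - 1 / (p : ℝ) ^ 2) * ∑ l ∈ Finset.range M, F l := by
  have h1 : ∀ l, F l * (1 - if p ∣ l then 1 / (p : ℝ) else 0) =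
      F l - (1 / (p : ℝ)) * (if p ∣ l then F l else 0) := fun l => by
    split_ifs <;> ring
  simp only [h1]
  rw [Finset.sum_sub_distrib, ← Finset.mul_sum, sum_range_mul_periodic hF, mul_comm M p,
    sum_range_dvd hp0, sum_range_mul_coprime hF hp]
  have : (p : ℝ) ≠ 0 := by exact_mod_cast hp0.ne'
  field_simp

lemma sum_range_mul_sieveFactor {G : ℕ → ℝ} {Q : ℕ} (hG : Function.Periodic G Q) {T : Finset ℕ}
    (hT : ∀ p ∈ T, p.Prime) (hQ : ∀ p ∈ T, Nat.Coprime Q p) :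
    ∑ l ∈ Finset.range (Q * ∏ p ∈ T, p), G l * sieveFactor T l =
      (∏ p ∈ T, (p : ℝ)) * (∏ p ∈ T, (1 - 1 / (p : ℝ) ^ 2)) * ∑ l ∈ Finset.range Q, G l := by
  induction T using Finset.induction_on with
  | empty => simp [sieveFactor]
  | insert p T hpT ih =>
    have hp := hT p (Finset.mem_insert_self _ _)
    have hcop : Nat.Coprime (Q * ∏ q ∈ T, q) p :=
      Nat.Coprime.mul_left (hQ p (Finset.mem_insert_self _ _)) (Nat.Coprime.prod_left fun q hq =>
        (Nat.coprime_primes (hT q (Finset.mem_insert_of_mem hq)) hp).2 fun h => hpT (h ▸ hq))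
    have hper : Function.Periodic (fun l => G l * sieveFactor T l) (Q * ∏ q ∈ T, q) := by
      refine Function.Periodic.mul ?_ (sieveFactor_periodic fun q hq =>
        (Finset.dvd_prod_of_mem _ hq).mul_left Q)
      rw [mul_comm]
      exact hG.nat_mul _
    have h := sum_range_mul_one_sub hper hcop hp.pos
    rw [ih (fun q hq => hT q (Finset.mem_insert_of_mem hq))
      fun q hq => hQ q (Finset.mem_insert_of_mem hq)] at h
    rw [Finset.prod_insert hpT, Finset.prod_insert hpT, Finset.prod_insert hpT,
      mul_comm p, ← mul_assoc]
    rw [show ∀ a b c d e : ℝ, a * b * (c * d) * e = a * c * (b * d * e) by intros; ring]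
    rw [← h]
    refine Finset.sum_congr rfl fun l _ => ?_
    rw [sieveFactor, Finset.prod_insert hpT, ← sieveFactor]
    ring

/-- The window after `L` ends where `(l + c) % Q` reaches `Q - 1`. By double counting, `l` belongs
to the windows starting at the `(l + c) % Q` integers before it in its block, whence the sawtooth
weight. -/
lemma sum_range_window {F : ℕ → ℝ} {M Q c : ℕ} (hF : Function.Periodic F M) (hQM : Q ∣ M)
    (hQ : 0 < Q) :
    ∑ L ∈ Finset.range M, ∑ i ∈ Finset.range (Q - 1 - (L + c) % Q), F (L + i + 1) =
      ∑ l ∈ Finset.range M, (((l + c) % Q : ℕ) : ℝ) * F l := by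
  have h1 : ∀ L, ∑ i ∈ Finset.range (Q - 1 - (L + c) % Q), F (L + i + 1) =
      ∑ i ∈ Finset.range Q, if i + 1 ≤ (L + (i + 1) + c) % Q then F (L + (i + 1)) else 0 := by
    intro L
    rw [← Finset.sum_filter]
    refine Finset.sum_congr ?_ fun i _ => rfl
    ext i
    rw [Finset.mem_range, Finset.mem_filter, Finset.mem_range]
    have hw := Nat.mod_lt (L + c) hQ
    have hmod : (L + (i + 1) + c) % Q = ((L + c) % Q + (i + 1)) % Q := by
      rw [Nat.mod_add_mod]; congr 1; omega
    rw [hmod]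
    set w := (L + c) % Q
    constructor
    · intro h
      refine ⟨by omega, ?_⟩
      rw [Nat.mod_eq_of_lt (by omega)]
      omega
    · rintro ⟨h2, h3⟩
      by_contra h4
      rw [Nat.mod_eq_sub_mod (by omega), Nat.mod_eq_of_lt (by omega)] at h3
      omega
  simp only [h1]
  rw [Finset.sum_comm]
  have h2 : ∀ i, ∑ L ∈ Finset.range M,
      (if i + 1 ≤ (L + (i + 1) + c) % Q then F (L + (i + 1)) else 0) =
      ∑ l ∈ Finset.range M, if i + 1 ≤ (l + c) % Q then F l else 0 := fun i => by
    refine sum_range_periodic_shift (F := fun l => if i + 1 ≤ (l + c) % Q then F l else 0)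
      (fun l => ?_) (i + 1)
    obtain ⟨t, rfl⟩ := hQM
    simp only
    rw [hF, show l + Q * t + c = l + c + Q * t by ring, Nat.add_mul_mod_self_left]
  simp only [h2]
  rw [Finset.sum_comm]
  refine Finset.sum_congr rfl fun l _ => ?_
  rw [← Finset.sum_filter, Finset.sum_const, nsmul_eq_mul]
  congr 2
  have : (Finset.range Q).filter (fun i => i + 1 ≤ (l + c) % Q) = Finset.range ((l + c) % Q) := by
    ext i
    have := Nat.mod_lt (l + c) hQ
    rw [Finset.mem_filter, Finset.mem_range, Finset.mem_range]
    omega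
  rw [this, Finset.card_range]

lemma sum_range_mod (Q c : ℕ) :
    ∑ l ∈ Finset.range Q, (((l + c) % Q : ℕ) : ℝ) = Q * (Q - 1) / 2 := by
  rw [sum_range_periodic_shift (F := fun l => ((l % Q : ℕ) : ℝ)) (fun l => by simp)]
  rw [Finset.sum_congr rfl fun l hl => by rw [Nat.mod_eq_of_lt (Finset.mem_range.1 hl)],
    ← Nat.cast_sum]
  have h := Finset.sum_range_id_mul_two Q
  rcases Nat.eq_zero_or_pos Q with rfl | hQ
  · simp
  have h' : ((∑ i ∈ Finset.range Q, i : ℕ) : ℝ) * 2 = Q * (Q - 1) := by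
    rw [← Nat.cast_pred hQ]; exact_mod_cast h
  linarith

/-- The sum `∑_{l < Q, g ∣ l} ((l + c) mod Q) ∏_p (1 - [p ∣ l] / p)` over the listed primes `p`,
computed by inclusion-exclusion. -/
def sawtoothSum (Q c : ℕ) : List ℕ → ℕ → ℚ
  | [], g => (Q / g) * ((c % g : ℕ) : ℚ) + g * ((Q / g) * (Q / g - 1) / 2)
  | p :: ps, g => sawtoothSum Q c ps g - 1 / p * sawtoothSum Q c ps (g * p)

lemma sum_range_dvd_sawtooth {Q c g : ℕ} (hQ : 0 < Q) (hg : g ∣ Q) :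
    ∑ l ∈ Finset.range Q, (if g ∣ l then (((l + c) % Q : ℕ) : ℝ) else 0) =
      (Q / g) * ((c % g : ℕ) : ℝ) + g * ((Q / g) * (Q / g - 1) / 2) := by
  obtain ⟨h, rfl⟩ := hg
  have hg0 : 0 < g := Nat.pos_of_mul_pos_right hQ
  have hg' : (g : ℝ) ≠ 0 := by exact_mod_cast hg0.ne'
  -- Shifting by `c` turns the multiples of `g` into the class of `c` modulo `g`, so the sum becomes
  -- an arithmetic progression.
  have e1 : ∀ l, (if g ∣ l then (((l + c) % (g * h) : ℕ) : ℝ) else 0) =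
      (fun u => if u % g = c % g then ((u % (g * h) : ℕ) : ℝ) else 0) (l + c) := fun l => by
    have : g ∣ l ↔ (l + c) % g = c % g := by
      rw [Nat.dvd_iff_mod_eq_zero]
      constructor
      · intro h; rw [Nat.add_mod, h, zero_add, Nat.mod_mod]
      · intro h
        have h1 : l + c ≡ 0 + c [MOD g] := by rw [zero_add]; exact h
        exact Nat.ModEq.add_right_cancel' c h1
    simp only [this]
  have hper : Function.Periodic (fun u => if u % g = c % g then ((u % (g * h) : ℕ) : ℝ) else 0)
      (g * h) := fun u => by simp
  rw [Finset.sum_congr rfl fun l _ => e1 l, sum_range_periodic_shift hper]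
  have e2 : ∀ n ≤ h, ∑ u ∈ Finset.range (g * n),
      (if u % g = c % g then ((u % (g * h) : ℕ) : ℝ) else 0) =
      n * ((c % g : ℕ) : ℝ) + g * (n * (n - 1) / 2) := by
    intro n hn
    induction n with
    | zero => simp
    | succ n ih =>
      rw [Nat.mul_succ, Finset.sum_range_add, ih (by omega),
        Finset.sum_eq_single (c % g)]
      · have hlt : g * n + c % g < g * h := by
          have h1 := Nat.mod_lt c hg0
          have h2 : g * (n + 1) ≤ g * h := Nat.mul_le_mul_left g hn
          rw [Nat.mul_succ] at h2
          exact (Nat.add_lt_add_left h1 _).trans_le h2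
        rw [Nat.mul_add_mod, Nat.mod_mod, if_pos rfl, Nat.mod_eq_of_lt hlt]
        push_cast
        ring
      · intro b hb hne
        rw [Nat.mul_add_mod, Nat.mod_eq_of_lt (Finset.mem_range.1 hb), if_neg hne]
      · intro hn
        exact absurd (Finset.mem_range.2 (Nat.mod_lt c hg0)) hn
  rw [e2 h le_rfl]
  push_cast
  rw [mul_div_cancel_left₀ _ hg']

/-- Each factor is split into `1` and `-[p ∣ l]/p`. Squarefreeness of `Q` makes `g` and `p` coprime,
so the two divisibility conditions merge into `g * p ∣ l`. -/
lemma sum_range_sawtooth_mul_prod {Q c : ℕ} (hQ : 0 < Q) (hsq : Squarefree Q) (ps : List ℕ) :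
    ∀ g : ℕ, g * ps.prod ∣ Q →
      ∑ l ∈ Finset.range Q, (if g ∣ l then (((l + c) % Q : ℕ) : ℝ) *
        (ps.map fun p => 1 - if p ∣ l then 1 / (p : ℝ) else 0).prod else 0) =
        (sawtoothSum Q c ps g : ℝ) := by
  induction ps with
  | nil =>
    intro g hg
    rw [List.prod_nil, mul_one] at hg
    simp only [List.map_nil, List.prod_nil, mul_one]
    rw [sum_range_dvd_sawtooth hQ hg, sawtoothSum]
    push_cast
    rfl
  | cons p ps ih =>
    intro g hg
    rw [List.prod_cons, ← mul_assoc] at hg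
    have hgp : g * p ∣ Q := (dvd_mul_right _ _).trans hg
    have hcop : Nat.Coprime g p := Nat.coprime_of_squarefree_mul (hsq.squarefree_of_dvd hgp)
    have hdvd : g * ps.prod ∣ Q := by
      refine dvd_trans ?_ hg
      rw [mul_assoc, mul_comm p, ← mul_assoc]
      exact dvd_mul_right _ _
    rw [sawtoothSum]
    push_cast
    rw [← ih g hdvd, ← ih (g * p) hg, Finset.mul_sum, ← Finset.sum_sub_distrib]
    refine Finset.sum_congr rfl fun l _ => ?_
    have hiff : g * p ∣ l ↔ g ∣ l ∧ p ∣ l :=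
      ⟨fun h => ⟨(dvd_mul_right _ _).trans h, (dvd_mul_left _ _).trans h⟩,
        fun h => hcop.mul_dvd_of_dvd_of_dvd h.1 h.2⟩
    simp only [hiff, List.map_cons, List.prod_cons]
    by_cases h1 : g ∣ l <;> by_cases h2 : p ∣ l <;> simp only [h1, h2, if_true, if_false, and_true,
      and_false] <;> ring

/-- The numerical heart of `Ω_-` for `k = 2`. The modulus is the product of the primes up to `17`;
any shift for which this strict inequality holds would serve in place of `108743`. -/
lemma sawtoothSum_lt : 2 * sawtoothSum 510510 108743 [2, 3, 5, 7, 11, 13, 17] 1 <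
    510510 * (510510 - 2) * ([2, 3, 5, 7, 11, 13, 17].map fun p : ℚ => 1 - 1 / p ^ 2).prod := by
  norm_num [sawtoothSum]

end LatticeVisibility

end

/-! ### Passing to all primes, and `Ω_-` for `k = 2` -/

noncomputable section

namespace LatticeVisibility

lemma tendsto_prod_primesBelow_one_sub :
    Tendsto (fun n : ℕ => ∏ p ∈ Nat.primesBelow n, (1 - 1 / (p : ℝ) ^ 2)) atTop
      (𝓝 (1 / zeta 2)) := by
  let f : ℕ →*₀ ℝ :=
    { toFun := fun n => 1 / (n : ℝ) ^ 2
      map_zero' := by simp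
      map_one' := by simp
      map_mul' := fun a b => by push_cast; rw [mul_pow, one_div_mul_one_div] }
  have hs : Summable (fun n => ‖f n‖) :=
    (Real.summable_one_div_nat_pow.2 one_lt_two : Summable fun n : ℕ => 1 / (n : ℝ) ^ 2).norm
  have h := EulerProduct.eulerProduct_completely_multiplicative hs
  have hz : ∑' n, f n = zeta 2 := (zeta_eq_tsum le_rfl).symm
  rw [hz] at h
  have h2 := h.inv₀ (one_pos.trans (one_lt_zeta le_rfl)).ne'
  rw [one_div]
  refine h2.congr fun n => ?_
  rw [← Finset.prod_inv_distrib]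
  exact Finset.prod_congr rfl fun p _ => inv_inv _

/-- Over all primes `≥ N` the product would equal `1/ζ(2)` divided by the product below `N`. As the
hypothesis is strict, a finite set of primes already suffices. -/
lemma exists_prod_mul_lt {N : ℕ} {m B : ℝ}
    (h : m < B * ∏ p ∈ Nat.primesBelow N, (1 - 1 / (p : ℝ) ^ 2)) :
    ∃ T : Finset ℕ, (∀ p ∈ T, p.Prime ∧ N ≤ p) ∧
      (∏ p ∈ T, (1 - 1 / (p : ℝ) ^ 2)) * m < 1 / zeta 2 * B := by
  have hκ : 0 < 1 / zeta 2 := one_div_pos.2 (one_pos.trans (one_lt_zeta le_rfl))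
  set P := ∏ p ∈ Nat.primesBelow N, (1 - 1 / (p : ℝ) ^ 2) with hP
  have hP0 : 0 < P := Finset.prod_pos fun p hp => by
    have hp2 : (2 : ℝ) ≤ p := by exact_mod_cast (Nat.prime_of_mem_primesBelow hp).two_le
    have : 1 / (p : ℝ) ^ 2 < 1 := by
      rw [div_lt_one (by positivity)]
      nlinarith
    linarith
  have hlim := (tendsto_prod_primesBelow_one_sub.div_const P).mul_const m
  have hltlim : 1 / zeta 2 / P * m < 1 / zeta 2 * B := by
    rw [div_mul_eq_mul_div, div_lt_iff₀ hP0, mul_assoc]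
    gcongr
  obtain ⟨n, hNn, hn⟩ := ((eventually_ge_atTop N).and
    (hlim.eventually (gt_mem_nhds hltlim))).exists
  have hsub : Nat.primesBelow N ⊆ Nat.primesBelow n := fun p hp => by
    rw [Nat.mem_primesBelow] at hp ⊢
    exact ⟨by omega, hp.2⟩
  refine ⟨Nat.primesBelow n \ Nat.primesBelow N, fun p hp => ?_, ?_⟩
  · have hp' := Finset.mem_sdiff.1 hp
    have hpp := Nat.prime_of_mem_primesBelow hp'.1
    refine ⟨hpp, not_lt.1 fun h => hp'.2 (Nat.mem_primesBelow.2 ⟨h, hpp⟩)⟩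
  · refine lt_of_eq_of_lt ?_ hn
    congr 1
    rw [← Finset.prod_sdiff hsub, mul_div_cancel_right₀ _ hP0.ne']

lemma exists_sum_sawtooth_lt : ∃ Q c : ℕ, 0 < Q ∧ (∀ p ∈ Nat.primesBelow 18, p ∣ Q) ∧
    (∀ p, p.Prime → p ∣ Q → p < 18) ∧
    ∑ l ∈ Finset.range Q, (((l + c) % Q : ℕ) : ℝ) * sieveFactor (Nat.primesBelow 18) l <
      (Q * (Q - 2) / 2 : ℝ) * ∏ p ∈ Nat.primesBelow 18, (1 - 1 / (p : ℝ) ^ 2) := by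
  have hS : Nat.primesBelow 18 = {2, 3, 5, 7, 11, 13, 17} := by decide
  have hfac : 510510 = 2 * 3 * 5 * 7 * 11 * 13 * 17 := by norm_num
  obtain ⟨Q, hQ⟩ : ∃ Q : ℕ, Q = 510510 := ⟨_, rfl⟩
  have hsf : Squarefree Q := by
    rw [hQ, hfac]
    simp only [Nat.squarefree_mul_iff]
    refine ⟨by norm_num, ⟨by norm_num, ⟨by norm_num, ⟨by norm_num, ⟨by norm_num, ⟨by norm_num,
      ?_, ?_⟩, ?_⟩, ?_⟩, ?_⟩, ?_⟩, ?_⟩ <;> exact (Nat.Prime.prime (by norm_num)).squarefree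
  refine ⟨Q, 108743, by omega, fun p hp => ?_, fun p hp hpQ => ?_, ?_⟩
  · rw [hS] at hp
    rw [hQ]
    simp only [Finset.mem_insert, Finset.mem_singleton] at hp
    rcases hp with rfl | rfl | rfl | rfl | rfl | rfl | rfl <;> norm_num
  · rw [hQ, hfac] at hpQ
    simp only [hp.dvd_mul] at hpQ
    rcases hpQ with ((((((h | h) | h) | h) | h) | h) | h) <;>
      exact (Nat.le_of_dvd (by norm_num) h).trans_lt (by norm_num)
  · have hval := sum_range_sawtooth_mul_prod (c := 108743) (Nat.pos_of_ne_zero hsf.ne_zero) hsf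
      [2, 3, 5, 7, 11, 13, 17] 1 (by rw [hQ]; norm_num)
    have h := sawtoothSum_lt
    rw [← hQ] at h
    have h' : ((2 * sawtoothSum Q 108743 [2, 3, 5, 7, 11, 13, 17] 1 : ℚ) : ℝ) <
        ((510510 * (510510 - 2) *
          ([2, 3, 5, 7, 11, 13, 17].map fun p : ℚ => 1 - 1 / p ^ 2).prod : ℚ) : ℝ) := by
      exact_mod_cast h
    rw [Rat.cast_mul, ← hval] at h'
    have hsum : ∑ l ∈ Finset.range Q, (((l + 108743) % Q : ℕ) : ℝ) *
        sieveFactor (Nat.primesBelow 18) l = ∑ l ∈ Finset.range Q,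
        (if 1 ∣ l then (((l + 108743) % Q : ℕ) : ℝ) *
          ([2, 3, 5, 7, 11, 13, 17].map fun p : ℕ => 1 - if p ∣ l then 1 / (p : ℝ) else 0).prod
          else 0) := by
      refine Finset.sum_congr rfl fun l _ => ?_
      rw [if_pos (one_dvd l), sieveFactor, hS]
      rfl
    have hQr : (Q : ℝ) = 510510 := by rw [hQ]; norm_num
    rw [hsum, hS, hQr]
    push_cast at h'
    simp only [List.map_cons, List.map_nil, List.prod_cons, List.prod_nil] at h' ⊢
    norm_num at h' ⊢
    linarith

/-- Here `f(l)` is a finite product majorising `φ(l)/l`, and `e(L)` is the distance to the next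
integer congruent to `-1 - c` modulo `Q`. Summing over windows gives `κ M (Q-1)` from the constant
part; it exceeds twice the weighted sum of `f` by more than `κ M`, thanks to the `Q - 2` in the
numerical inequality. -/
lemma exists_periodic_minorant : ∃ (Q M : ℕ) (f : ℕ → ℝ) (e : ℕ → ℕ), 0 < M ∧
    Function.Periodic f M ∧ Function.Periodic e M ∧ (∀ l, f l ≤ 1) ∧ (∀ l, e l ≤ Q) ∧
    (∀ l, l ≠ 0 → (Nat.totient l : ℝ) ≤ l * f l) ∧
    M * (1 / zeta 2) < ∑ L ∈ Finset.range M, ∑ i ∈ Finset.range (e L),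
      (2 * (1 / zeta 2) - 2 * f (L + i + 1)) := by
  obtain ⟨Q, c, hQ0, hSQ, hQ18, hQlt⟩ := exists_sum_sawtooth_lt
  obtain ⟨T, hT', hlt⟩ := exists_prod_mul_lt hQlt
  have hT : ∀ p ∈ T, p.Prime := fun p hp => (hT' p hp).1
  have hQT : ∀ p ∈ T, Nat.Coprime Q p := fun p hp =>
    ((Nat.Prime.coprime_iff_not_dvd (hT p hp)).2 fun h =>
      absurd (hQ18 p (hT p hp) h) (not_lt.2 (hT' p hp).2)).symm
  set S := Nat.primesBelow 18
  set κ := 1 / zeta 2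
  have hST : Disjoint S T := Finset.disjoint_left.2 fun p hpS hpT => by
    have h1 := Nat.Coprime.eq_one_of_dvd (hQT p hpT).symm (hSQ p hpS)
    exact (hT p hpT).one_lt.ne' h1
  have hQM : Q ∣ Q * ∏ p ∈ T, p := dvd_mul_right _ _
  have hTpos : 0 < ∏ p ∈ T, p := Finset.prod_pos fun p hp => (hT p hp).pos
  have hfper : Function.Periodic (sieveFactor (S ∪ T)) (Q * ∏ p ∈ T, p) :=
    sieveFactor_periodic fun p hp => (Finset.mem_union.1 hp).elim
      (fun h => (hSQ p h).trans hQM) fun h => (Finset.dvd_prod_of_mem _ h).mul_left Q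
  refine ⟨Q, Q * ∏ p ∈ T, p, sieveFactor (S ∪ T), fun L => Q - 1 - (L + c) % Q,
    Nat.mul_pos hQ0 hTpos, hfper, ?_, sieveFactor_le_one _, fun l => by simp only; omega,
    fun l hl => totient_le_mul_sieveFactor (fun p hp => (Finset.mem_union.1 hp).elim
      Nat.prime_of_mem_primesBelow (hT p)) hl, ?_⟩
  · intro L
    simp only
    rw [show L + Q * (∏ p ∈ T, p) + c = L + c + Q * ∏ p ∈ T, p by ring, Nat.add_mul_mod_self_left]
  have hw : Function.Periodic (fun l => (((l + c) % Q : ℕ) : ℝ)) Q := fun l => by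
    simp only
    rw [show l + Q + c = l + c + Q by ring, Nat.add_mod_right]
  have hwin := sum_range_window (F := fun l => 2 * κ - 2 * sieveFactor (S ∪ T) l) (c := c)
    (fun l => by simp only [hfper l]) hQM hQ0
  have hG : Function.Periodic (fun l => (((l + c) % Q : ℕ) : ℝ) * sieveFactor S l) Q :=
    hw.mul (sieveFactor_periodic hSQ)
  have hsum := sum_range_mul_sieveFactor hG hT hQT
  have hwsum : ∑ l ∈ Finset.range (Q * ∏ p ∈ T, p), (((l + c) % Q : ℕ) : ℝ) =
      ((∏ p ∈ T, p : ℕ) : ℝ) * (Q * (Q - 1) / 2) := by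
    rw [sum_range_mul_periodic hw, sum_range_mod]
  have hsplit : ∑ l ∈ Finset.range (Q * ∏ p ∈ T, p), (((l + c) % Q : ℕ) : ℝ) *
      (2 * κ - 2 * sieveFactor (S ∪ T) l) =
      2 * κ * (((∏ p ∈ T, p : ℕ) : ℝ) * (Q * (Q - 1) / 2)) -
      2 * ((∏ p ∈ T, (p : ℝ)) * (∏ p ∈ T, (1 - 1 / (p : ℝ) ^ 2)) *
        ∑ l ∈ Finset.range Q, (((l + c) % Q : ℕ) : ℝ) * sieveFactor S l) := by
    rw [← hsum, ← hwsum, Finset.mul_sum, Finset.mul_sum, ← Finset.sum_sub_distrib]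
    refine Finset.sum_congr rfl fun l _ => ?_
    rw [sieveFactor, Finset.prod_union hST, ← sieveFactor, ← sieveFactor]
    ring
  have hTr : (0 : ℝ) < ∏ p ∈ T, (p : ℝ) := by
    rw [← Nat.cast_prod]; exact_mod_cast hTpos
  rw [hwin, hsplit, Nat.cast_mul, Nat.cast_prod]
  have := mul_lt_mul_of_pos_left hlt hTr
  linear_combination 2 * this

lemma isOmegaMinus_two :
    IsOmegaMinus (fun L : ℕ => (count (visibleFromOrigin 2) L : ℝ) - (L : ℝ) ^ 2 / zeta 2)
      (fun L : ℕ => (L : ℝ) ^ (2 - 1)) := by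
  by_contra hcon
  have hκ : 0 < 1 / zeta 2 := one_div_pos.2 (one_pos.trans (one_lt_zeta le_rfl))
  obtain ⟨Q, M, f, e, hM, hfM, heM, hf1, heQ, hft, hmean⟩ := exists_periodic_minorant
  set κ := 1 / zeta 2 with hκdef
  have hM' : (0 : ℝ) < M := by exact_mod_cast hM
  set θ : ℕ → ℝ := fun L => ∑ i ∈ Finset.range (e L), (2 * κ - 2 * f (L + i + 1)) with hθ
  have hθM : Function.Periodic θ M := fun L => by
    simp only [hθ]
    rw [heM L]
    refine Finset.sum_congr rfl fun i _ => ?_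
    rw [show L + M + i + 1 = L + i + 1 + M by ring, hfM]
  -- Half the gap between the mean of `θ` and `κ`, so that `θ - κ - ε` still has mean `ε > 0`.
  set ε := ((∑ L ∈ Finset.range M, θ L) / M - κ) / 2 with hε
  have hεM : 2 * ε * M = (∑ L ∈ Finset.range M, θ L) - κ * M := by
    rw [hε]; field_simp
  have hε0 : 0 < ε := by
    have : 0 < 2 * ε * M := by rw [hεM]; linarith
    nlinarith
  -- In the constant, `εQ` pays for `ε e(L)`, and `2Q²` for replacing `L + i + 1` by `L` in at most
  -- `Q` increments.
  refine not_periodic_le_coprimeError_of_eventually (p := fun L => θ L - κ - ε) hM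
    (fun L => by simp only [hθM L]) ?_ (s := 1) (C := ε * Q + 2 * Q ^ 2) (by simp) ?_
  · rw [Finset.sum_sub_distrib, Finset.sum_sub_distrib, Finset.sum_const, Finset.sum_const,
      Finset.card_range, nsmul_eq_mul, nsmul_eq_mul]
    nlinarith
  have hev := not_frequently.1 fun hfr => hcon ⟨ε, hε0, hfr⟩
  obtain ⟨N, hN⟩ := eventually_atTop.1 hev
  filter_upwards [eventually_ge_atTop N, eventually_ge_atTop 1] with L hLN hL1
  -- The contrary assumption is used at the end of the window and carried back to `L` through the
  -- totient increments.
  have h1 := hN (L + e L) (by omega)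
  simp only [Nat.add_one_sub_one, pow_one, not_le] at h1
  rw [← coprimeError_natCast two_ne_zero, coprimeError_two_add hL1] at h1
  have heQ' : (e L : ℝ) ≤ Q := by exact_mod_cast heQ L
  have h2 : ∑ i ∈ Finset.range (e L),
      (2 * (Nat.totient (L + i + 1) : ℝ) - (2 * ((L + i : ℕ) : ℝ) + 1) / zeta 2) ≤
      ∑ i ∈ Finset.range (e L), (2 * (Q : ℝ) - L * (2 * κ - 2 * f (L + i + 1))) := by
    refine Finset.sum_le_sum fun i hi => ?_
    have hφ := hft (L + i + 1) (by omega)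
    have hiQ : ((i : ℝ) + 1) ≤ Q := by
      exact_mod_cast (Finset.mem_range.1 hi).trans_le (heQ L)
    have hi0 : (0 : ℝ) ≤ i := by positivity
    have hfl : ((i : ℝ) + 1) * f (L + i + 1) ≤ ((i : ℝ) + 1) * 1 := by gcongr; exact hf1 _
    rw [← mul_one_div (2 * ((L + i : ℕ) : ℝ) + 1), ← hκdef]
    push_cast at hφ ⊢
    nlinarith [mul_nonneg hi0 hκ.le]
  rw [Finset.sum_sub_distrib (fun _ => 2 * (Q : ℝ)), Finset.sum_const, Finset.card_range,
    nsmul_eq_mul, ← Finset.mul_sum] at h2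
  have h3 : (e L : ℝ) * (2 * Q) ≤ 2 * (Q : ℝ) ^ 2 := by
    nlinarith [(Nat.cast_nonneg Q : (0 : ℝ) ≤ Q)]
  have h4 : ε * e L ≤ ε * Q := by gcongr
  have h5 : θ L = ∑ i ∈ Finset.range (e L), (2 * κ - 2 * f (L + i + 1)) := rfl
  rw [← h5] at h2
  rw [← mul_one_div (L : ℝ) (zeta 2), ← hκdef]
  have h6 : ((L + e L : ℕ) : ℝ) = L + e L := Nat.cast_add _ _
  rw [h6] at h1
  nlinarith

end LatticeVisibility

end

theorem theorem1p2 (k : ℕ) (hk : 2 ≤ k) :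
    LatticeVisibility.IsOmegaPlusMinus
      (fun L : ℕ => (LatticeVisibility.count (LatticeVisibility.visibleFromOrigin k) L : ℝ)
        - (L : ℝ) ^ k / LatticeVisibility.zeta k)
      (fun L : ℕ => (L : ℝ) ^ (k - 1)) ∧
    (LatticeVisibility.HasAsymptoticDensity (LatticeVisibility.visibleFromOrigin k)
        (1 / LatticeVisibility.zeta k) ∧
      LatticeVisibility.schnirelmannDensity (LatticeVisibility.visibleFromOrigin k)
        < 1 / LatticeVisibility.zeta k) ∧
    (3 ≤ k →
      (fun L : ℕ => (LatticeVisibility.count (LatticeVisibility.visibleFromOrigin k) L : ℝ)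
        - ((L : ℝ) ^ k / LatticeVisibility.zeta k
          - (k : ℝ) * LatticeVisibility.fracSum k L * (L : ℝ) ^ (k - 1)))
      =O[atTop] (fun L : ℕ => (L : ℝ) ^ (k - 2) * Real.log (L : ℝ))) := by
  have hΩ : LatticeVisibility.IsOmegaPlusMinus
      (fun L : ℕ => (LatticeVisibility.count (LatticeVisibility.visibleFromOrigin k) L : ℝ)
        - (L : ℝ) ^ k / LatticeVisibility.zeta k)
      (fun L : ℕ => (L : ℝ) ^ (k - 1)) := by
    rcases hk.eq_or_lt with rfl | hk3
    · exact ⟨LatticeVisibility.isOmegaPlus_two, LatticeVisibility.isOmegaMinus_two⟩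
    · exact ⟨LatticeVisibility.isOmegaPlus_of_three_le hk3,
        LatticeVisibility.isOmegaMinus_of_three_le hk3⟩
  exact ⟨hΩ, ⟨LatticeVisibility.hasAsymptoticDensity_visibleFromOrigin hk,
    LatticeVisibility.schnirelmannDensity_lt hΩ.2⟩,
    LatticeVisibility.coprimeError_add_fracSum_isBigO⟩
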